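/- Throughout, a $p$-complement in a finite group $G$ is a subgroup of $G$ whose index is a power of the prime $p$ and whose order is coprime to $p$. Let $\mathcal{NC}$ be the set of primes $p$ such that $p^k=(q^d-1)/(q-1)$ for some prime power $q$ and integers $d\ge 3$, $k\ge 1$. Let $p\in\mathcal{NC}$. For all such $q,d,k$ let $V=\mathbb F_q^d$, let $U_0$ and $U_1$ be subspaces of $V$ of dimensions $1$ and $d-1$, let $H={\rm PSL}_d(q)$, $\tilde H={\rm GL}_d(q)$ and $\overline H={\rm AGL}_d(q)=V\rtimes\tilde H$, and for $i=0,1$ let $H_i\le H$ and $\tilde H_i\le\tilde H$ be the stabilisers of $U_i$, and $\overline H_i=V\rtimes\tilde H_i\le\overline H$. For $K\in\{H,\overline H\}$ and $\phi:\{1,\dots,m\}\to\{0,1\}$ let $K_\phi=K_{\phi(1)}\times\cdots\times K_{\phi(m)}\le K^m$. 1. For every $m\ge 0$ the subgroups $H_\phi$ are $p$-complements in $G=H^m$, they are pairwise non-conjugate in $G$, and every $p$-complement in $G$ is conjugate to one of them; so $G$ has exactly $2^m$ conjugacy classes of $p$-complements. All $p$-complements in $G$ are conjugate in ${\rm Aut}\,G$.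 2. Let $e\ge 1$, $m=p^e$ and $G=H\wr C_m=H^m\rtimes C_m$, with $C_m$ cyclically shifting the coordinates. The subgroups $H_\phi\le H^m$ are $p$-complements in $G$, and all $p$-complements in $G$ are isomorphic. The subgroups $H_\phi$ and $H_\psi$ are conjugate in $G$ if and only if $\phi$ and $\psi$ differ by a cyclic shift. Each $\phi$ has $p^f$ distinct images under cyclic shifts for some $f\in\{0,\dots,e\}$, and then $H_\phi$ has exactly $p^{km+f}$ conjugates in $G$; every $f\in\{0,\dots,e\}$ occurs for some $\phi$. The group ${\rm Aut}\,G$ has at least $e+1$ orbits on the $p$-complements of $G$. 3. The subgroups $\tilde H_0$ and $\tilde H_1$ are $p$-complements in $\tilde H$ which are conjugate in ${\rm Aut}\,\tilde H$ but not in $\tilde H$. The subgroups $\overline H_0$ and $\overline H_1$ are $p$-complements in $\overline H$, and $\overline H_0\not\cong\overline H_1$. For every $m\ge 0$ the subgroups $\overline H_\phi$ are $2^m$ mutually non-conjugate $p$-complements in $G=\overline H^m$; $\overline H_\phi\cong\overline H_\psi$ if and only if $|\phi^{-1}(1)|=|\psi^{-1}(1)|$; and $G$ has exactly $m+1$ isomorphism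 classes of $p$-complements. In particular, for each $p\in\mathcal{NC}$: for every $m\ge 0$ there is a finite group whose $p$-complements are all conjugate under automorphisms but form exactly $2^m$ conjugacy classes; for every $e\ge 1$ there is a finite group whose $p$-complements are all isomorphic but form at least $e+1$ orbits under its automorphism group; and for every $m\ge 0$ there is a finite group with exactly $m+1$ isomorphism classes of $p$-complements. -/

import Mathlib

namespace PComplements

/-- A `p`-complement: a subgroup of index a power of `p` and of order coprime to `p`. -/
def IsPComplement (p : ℕ) {G : Type*} [Group G] (K : Subgroup G) : Prop :=
  (∃ n : ℕ, K.index = p ^ n) ∧ (Nat.card K).Coprime p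

/-- `K` and `L` are conjugate in `G`. -/
def ConjIn {G : Type*} [Group G] (K L : Subgroup G) : Prop :=
  ∃ g : G, K.map (MulAut.conj g).toMonoidHom = L

/-- `K` and `L` are conjugate in `Aut G`, i.e. some automorphism of `G` maps `K` onto `L`. -/
def AutConj {G : Type*} [Group G] (K L : Subgroup G) : Prop :=
  ∃ α : G ≃* G, K.map α.toMonoidHom = L

/-- `K` and `L` are isomorphic groups. -/
def Isom {G : Type*} [Group G] (K L : Subgroup G) : Prop :=
  Nonempty (K ≃* L)

theorem conjIn_equivalence (G : Type*) [Group G] :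
    Equivalence (ConjIn : Subgroup G → Subgroup G → Prop) where
  refl K := ⟨1, by ext x; simp⟩
  symm := by
    rintro K _ ⟨g, rfl⟩
    exact ⟨g⁻¹, by ext x; simp [Subgroup.mem_map, mul_assoc]⟩
  trans := by
    rintro K _ _ ⟨g, rfl⟩ ⟨h, rfl⟩
    exact ⟨h * g, by ext x; simp [Subgroup.mem_map]⟩

theorem autConj_equivalence (G : Type*) [Group G] :
    Equivalence (AutConj : Subgroup G → Subgroup G → Prop) where
  refl K := ⟨MulEquiv.refl G, by ext x; simp [Subgroup.mem_map]⟩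
  symm := by
    rintro K _ ⟨g, rfl⟩
    exact ⟨g.symm, by ext x; simp⟩
  trans := by
    rintro K _ _ ⟨g, rfl⟩ ⟨h, rfl⟩
    exact ⟨g.trans h, by ext x; simp [Subgroup.mem_map]⟩

theorem isom_equivalence (G : Type*) [Group G] :
    Equivalence (Isom : Subgroup G → Subgroup G → Prop) where
  refl K := ⟨MulEquiv.refl K⟩
  symm := fun ⟨f⟩ => ⟨f.symm⟩
  trans := fun ⟨f⟩ ⟨g⟩ => ⟨f.trans g⟩

/-- The `p`-complements of `G`. -/
abbrev PCompl (p : ℕ) (G : Type*) [Group G] : Type _ :=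
  {K : Subgroup G // IsPComplement p K}

/-- The number of conjugacy classes of `p`-complements of `G`. -/
noncomputable def numConjClasses (p : ℕ) (G : Type*) [Group G] : ℕ :=
  Nat.card (Quotient (Setoid.comap (Subtype.val : PCompl p G → Subgroup G)
    ⟨ConjIn, conjIn_equivalence G⟩))

/-- The number of orbits of `Aut G` on the `p`-complements of `G`. -/
noncomputable def numAutOrbits (p : ℕ) (G : Type*) [Group G] : ℕ :=
  Nat.card (Quotient (Setoid.comap (Subtype.val : PCompl p G → Subgroup G)
    ⟨AutConj, autConj_equivalence G⟩))

/-- The number of isomorphism classes of `p`-complements of `G`. -/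
noncomputable def numIsoClasses (p : ℕ) (G : Type*) [Group G] : ℕ :=
  Nat.card (Quotient (Setoid.comap (Subtype.val : PCompl p G → Subgroup G)
    ⟨Isom, isom_equivalence G⟩))

/-- The set of primes `p` such that `p ^ k = (q ^ d - 1) / (q - 1)` for some prime power `q` and
some integers `d ≥ 3` and `k ≥ 1`. -/
def NC : Set ℕ :=
  {p | p.Prime ∧ ∃ q d k : ℕ, IsPrimePow q ∧ 3 ≤ d ∧ 1 ≤ k ∧
    (p : ℚ) ^ k = ((q : ℚ) ^ d - 1) / ((q : ℚ) - 1)}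

section Stabilizers

variable {F : Type*} [Field F] {d : ℕ}

/-- The group of invertible linear maps of `F ^ d` that stabilise the subspace `U`. -/
def linStab (U : Submodule F (Fin d → F)) :
    Subgroup ((Fin d → F) ≃ₗ[F] (Fin d → F)) where
  carrier := {g | U.map g.toLinearMap = U}
  one_mem' := Submodule.map_id U
  mul_mem' := by
    intro a b ha hb
    have h : (a * b).toLinearMap = a.toLinearMap.comp b.toLinearMap := rfl
    simp only [Set.mem_ofPred_eq] at ha hb ⊢
    rw [h, Submodule.map_comp, hb, ha]
  inv_mem' := by
    intro a ha
    have h : a⁻¹.toLinearMap.comp a.toLinearMap = LinearMap.id := by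
      refine LinearMap.ext fun x => ?_
      exact a.symm_apply_apply x
    simp only [Set.mem_ofPred_eq] at ha ⊢
    conv_lhs => rw [← ha]
    rw [← Submodule.map_comp, h, Submodule.map_id]

/-- The stabiliser of the subspace `U` in `PSL_d(F)`. Since the centre of `SL_d(F)` consists of
scalars, which stabilise every subspace, this is the image of the stabiliser in `SL_d(F)`. -/
def pslStab (U : Submodule F (Fin d → F)) :
    Subgroup (Matrix.ProjectiveSpecialLinearGroup (Fin d) F) :=
  ((linStab U).comap Matrix.SpecialLinearGroup.toLin').map (QuotientGroup.mk' _)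

/-- The stabiliser of the subspace `U` in `GL_d(F)`. -/
def glStab (U : Submodule F (Fin d → F)) : Subgroup (Matrix.GeneralLinearGroup (Fin d) F) :=
  (linStab U).comap
    ((LinearMap.GeneralLinearGroup.generalLinearEquiv F (Fin d → F)).toMonoidHom.comp
      (Matrix.GeneralLinearGroup.toLin (n := Fin d) (R := F)).toMonoidHom)

variable (F d) in
/-- The affine group `AGL_d(F)` of all invertible affine maps of `V = F ^ d` to itself. -/
abbrev AGL : Type _ := (Fin d → F) ≃ᵃ[F] (Fin d → F)

/-- The subgroup `V ⋊ Stab(U)` of `AGL_d(F) = V ⋊ GL_d(F)`: the affine maps whose linear part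
stabilises the subspace `U`. -/
def aglStab (U : Submodule F (Fin d → F)) : Subgroup (AGL F d) :=
  (linStab U).comap AffineEquiv.linearHom

end Stabilizers

/-- For subgroups `K 0`, `K 1` of `H` and `φ : ι → {0, 1}`, the subgroup `∏ i, K (φ i)` of the
cartesian power `ι → H`. -/
def powSub {H : Type*} [Group H] {ι : Type*} (K : Fin 2 → Subgroup H) (φ : ι → Fin 2) :
    Subgroup (ι → H) :=
  Subgroup.pi Set.univ fun i => K (φ i)

/-- The wreath product `H ≀ C_m = H ^ m ⋊ C_m`: the coordinates of the base group are indexed by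
the cyclic group `C_m`, which permutes them regularly, that is, by cyclic shifts. -/
abbrev CyclicWreath (H : Type*) [Group H] (m : ℕ) : Type _ :=
  RegularWreathProduct H (Multiplicative (ZMod m))

/-- The embedding of the base group `H ^ m` in `H ≀ C_m`. -/
def baseHom (H : Type*) [Group H] (m : ℕ) :
    (Multiplicative (ZMod m) → H) →* CyclicWreath H m where
  toFun f := ⟨f, 1⟩
  map_one' := rfl
  map_mul' f g := by ext <;> simp

/-- The subgroup `∏ i, K (φ i)` of the base group `H ^ m` of `H ≀ C_m`. -/
def wreathSub {H : Type*} [Group H] {m : ℕ} (K : Fin 2 → Subgroup H)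
    (φ : Multiplicative (ZMod m) → Fin 2) : Subgroup (CyclicWreath H m) :=
  (powSub K φ).map (baseHom H m)

/-- The image of `φ` under the cyclic shift of its domain by `c`. -/
def shift {m : ℕ} (c : Multiplicative (ZMod m)) (φ : Multiplicative (ZMod m) → Fin 2) :
    Multiplicative (ZMod m) → Fin 2 :=
  fun x => φ (c * x)

end PComplements

open PComplements

/-! The core is a classification. Let `X` be a linear group on `V = F ^ d`, `|F| = q`, that contains
every element whose order divides the characteristic (so all transvections), has an inverse
transpose automorphism, and has order dividing `p ^ k * M` with `M` prime to `p`, where `p ^ k = (q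
^ d - 1) / (q - 1)`. Its `p`-complements are exactly the stabilisers of lines and of hyperplanes.

There are `p ^ k` lines, so a line stabiliser has index `p ^ k`; duality gives the same for
hyperplanes. By lifting the exponent, `p` divides no `q ^ j - 1` with `0 < j < d`
(`not_dvd_pow_sub_one`), so `p ^ k` is the full `p`-part of `|GL_d(q)|` and these stabilisers are
`p`-complements. Conversely, the index of a `p`-complement `K` is prime to the characteristic, so
after conjugation `K` contains all transvections with a given centre `v`. The lines in the `K`-orbit
of `v` then fill an invariant subspace `W`. It is proper, as `K` cannot permute `p ^ k` lines
transitively, and a lower bound for the index of its stabiliser forces dimension `1` or `d - 1`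
(`IsPComplement.exists_conjIn_repStab`).

No `p`-complement properly contains another (`IsPComplement.eq_of_le`). Hence `p`-complements of `H
^ m` are products, and the classification passes between a group and its quotient by a kernel of
order prime to `p`: from `SL` to `PSL` and from `GL` to `AGL`.

In `H ≀ C_m` with `m = p ^ e`, all `p`-complements lie in the base group; the number of conjugates
is invariant under automorphisms and recovers the length of the shift orbit of `φ`. In `AGL`, the
translations by `U i` form the unique minimal normal subgroup of the stabiliser, so the order of the
socle of a product determines how often the hyperplane type occurs. -/

namespace PComplements

/-! ### Conjugacy and transfer of `p`-complements -/

section Basic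

variable {p : ℕ} {G G' : Type*} [Group G] [Group G']

theorem map_conj_eq (g : G) (K : Subgroup G) :
    K.map (MulAut.conj g).toMonoidHom = K.comap (MulAut.conj g⁻¹).toMonoidHom := by
  ext x
  simp only [Subgroup.mem_map, Subgroup.mem_comap, MulEquiv.toMonoidHom_eq_coe, MonoidHom.coe_coe,
    MulAut.conj_apply, inv_inv]
  constructor
  · rintro ⟨y, hy, rfl⟩
    simpa [mul_assoc] using hy
  · exact fun h => ⟨_, h, by group⟩

theorem mem_map_conj {g x : G} {K : Subgroup G} :
    x ∈ K.map (MulAut.conj g).toMonoidHom ↔ g⁻¹ * x * g ∈ K := by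
  rw [map_conj_eq]
  simp

theorem AutConj.refl (K : Subgroup G) : AutConj K K := (autConj_equivalence G).refl K

theorem AutConj.symm {K L : Subgroup G} (h : AutConj K L) : AutConj L K :=
  (autConj_equivalence G).symm h

theorem AutConj.trans {K L M : Subgroup G} (h : AutConj K L) (h' : AutConj L M) : AutConj K M :=
  (autConj_equivalence G).trans h h'

theorem ConjIn.refl (K : Subgroup G) : ConjIn K K := (conjIn_equivalence G).refl K

theorem ConjIn.symm {K L : Subgroup G} (h : ConjIn K L) : ConjIn L K :=
  (conjIn_equivalence G).symm h

theorem ConjIn.trans {K L M : Subgroup G} (h : ConjIn K L) (h' : ConjIn L M) : ConjIn K M :=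
  (conjIn_equivalence G).trans h h'

theorem ConjIn.autConj {K L : Subgroup G} : ConjIn K L → AutConj K L :=
  fun ⟨g, h⟩ => ⟨MulAut.conj g, h⟩

theorem AutConj.isom {K L : Subgroup G} : AutConj K L → Isom K L := by
  rintro ⟨α, rfl⟩
  exact ⟨K.equivMapOfInjective α.toMonoidHom α.injective⟩

theorem ConjIn.map {K L : Subgroup G} (f : G →* G') : ConjIn K L → ConjIn (K.map f) (L.map f) := by
  rintro ⟨g, rfl⟩
  refine ⟨f g, ?_⟩
  rw [Subgroup.map_map, Subgroup.map_map]
  congr 1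
  ext x
  simp

theorem comap_conj (f : G →* G') (K : Subgroup G') (g : G) :
    (K.map (MulAut.conj (f g)).toMonoidHom).comap f =
      (K.comap f).map (MulAut.conj g).toMonoidHom := by
  ext x
  rw [Subgroup.mem_comap, mem_map_conj, mem_map_conj, Subgroup.mem_comap]
  simp

theorem ConjIn.comap {K L : Subgroup G'} {f : G →* G'} (hf : Function.Surjective f) :
    ConjIn K L → ConjIn (K.comap f) (L.comap f) := by
  rintro ⟨g, rfl⟩
  obtain ⟨g, rfl⟩ := hf g
  exact ⟨g, (comap_conj f K g).symm⟩

/-- The relative index divides both a power of `p` and `|L|`, which are coprime. This upgrades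
inclusions to equalities throughout. -/
theorem IsPComplement.eq_of_le {K L : Subgroup G} (hK : IsPComplement p K)
    (hL : IsPComplement p L) (h : K ≤ L) : K = L := by
  obtain ⟨⟨n, hn⟩, -⟩ := hK
  have h1 : K.relIndex L ∣ p ^ n := hn ▸ Subgroup.relIndex_dvd_index_of_le h
  have h2 : K.relIndex L ∣ Nat.card L := K.relIndex_dvd_card L
  have h3 : K.relIndex L = 1 :=
    Nat.eq_one_of_dvd_coprimes (Nat.Coprime.pow_right n hL.2) h2 h1
  exact le_antisymm h (Subgroup.relIndex_eq_one.1 h3)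

theorem IsPComplement.map_equiv {K : Subgroup G} (hK : IsPComplement p K) (α : G ≃* G') :
    IsPComplement p (K.map α.toMonoidHom) := by
  refine ⟨?_, ?_⟩
  · obtain ⟨n, hn⟩ := hK.1
    exact ⟨n, by rw [← hn]; exact Subgroup.index_map_equiv K α⟩
  · rw [← Nat.card_congr (K.equivMapOfInjective α.toMonoidHom α.injective).toEquiv]
    exact hK.2

theorem IsPComplement.of_autConj {K L : Subgroup G} (hK : IsPComplement p K) :
    AutConj K L → IsPComplement p L := by
  rintro ⟨α, rfl⟩
  exact hK.map_equiv α

theorem IsPComplement.map {K : Subgroup G} (hp : p.Prime) (hK : IsPComplement p K) {f : G →* G'}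
    (hf : Function.Surjective f) : IsPComplement p (K.map f) := by
  refine ⟨?_, ?_⟩
  · obtain ⟨n, hn⟩ := hK.1
    obtain ⟨m, -, hm⟩ := (Nat.dvd_prime_pow hp).1 (hn ▸ K.index_map_dvd hf)
    exact ⟨m, hm⟩
  · exact Nat.Coprime.of_dvd_left (Subgroup.card_map_dvd K f) hK.2

theorem card_comap_of_surjective [Finite G] {f : G →* G'} (hf : Function.Surjective f)
    (K : Subgroup G') : Nat.card (K.comap f) = Nat.card f.ker * Nat.card K := by
  have : Finite G' := Finite.of_surjective f hf
  have h1 := (K.comap f).card_mul_index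
  rw [K.index_comap_of_surjective hf] at h1
  have h2 := f.ker.card_mul_index
  rw [Subgroup.index_ker, MonoidHom.range_eq_top.2 hf, Subgroup.card_top, ← K.card_mul_index,
    ← mul_assoc, ← h1] at h2
  exact (Nat.eq_of_mul_eq_mul_right (Nat.pos_of_ne_zero K.index_ne_zero_of_finite) h2).symm

/-- Taking the preimage keeps the index and multiplies the order by that of the kernel. -/
theorem isPComplement_comap_iff [Finite G] {f : G →* G'} (hf : Function.Surjective f)
    (hker : (Nat.card f.ker).Coprime p) {K : Subgroup G'} :
    IsPComplement p (K.comap f) ↔ IsPComplement p K := by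
  rw [IsPComplement, IsPComplement, K.index_comap_of_surjective hf, card_comap_of_surjective hf,
    Nat.coprime_mul_iff_left]
  tauto

theorem IsPComplement.comap_map [Finite G] {K : Subgroup G} (hp : p.Prime)
    (hK : IsPComplement p K) {f : G →* G'} (hf : Function.Surjective f)
    (hker : (Nat.card f.ker).Coprime p) : (K.map f).comap f = K :=
  (hK.eq_of_le ((isPComplement_comap_iff hf hker).2 (hK.map hp hf))
    (Subgroup.le_comap_map f K)).symm

theorem card_quotient_eq {α β : Type*} (s : Setoid α) (a : β → α)
    (h₁ : ∀ x y, s (a x) (a y) → x = y) (h₂ : ∀ y, ∃ x, s (a x) y) :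
    Nat.card (Quotient s) = Nat.card β :=
  (Nat.card_congr (Equiv.ofBijective (fun x => Quotient.mk s (a x))
    ⟨fun x y h => h₁ x y (Quotient.exact h), fun y => by
      induction y using Quotient.inductionOn with
      | _ y => exact (h₂ y).imp fun x h => Quotient.sound h⟩)).symm

end Basic

/-- Representatives `K 0`, `K 1` of the conjugacy classes of `p`-complements, all of index `p ^ k`
and self-normalising. -/
structure IsComplSystem (p k : ℕ) {H : Type*} [Group H] (K : Fin 2 → Subgroup H) : Prop where
  isPComplement : ∀ i, IsPComplement p (K i)
  index : ∀ i, (K i).index = p ^ k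
  exists_conjIn : ∀ L, IsPComplement p L → ∃ i, ConjIn (K i) L
  eq_of_conjIn : ∀ i j, ConjIn (K i) (K j) → i = j
  mem_of_map_conj : ∀ i g, (K i).map (MulAut.conj g).toMonoidHom = K i → g ∈ K i

/-! ### Systems of representatives under quotient maps; counting conjugates -/

namespace IsComplSystem

variable {p k : ℕ} {H H' : Type*} [Group H] [Group H'] {K : Fin 2 → Subgroup H}

theorem comap [Finite H'] (hp : p.Prime) (hK : IsComplSystem p k K) {f : H' →* H}
    (hf : Function.Surjective f) (hker : (Nat.card f.ker).Coprime p) :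
    IsComplSystem p k fun i => (K i).comap f where
  isPComplement i := (isPComplement_comap_iff hf hker).2 (hK.isPComplement i)
  index i := by rw [Subgroup.index_comap_of_surjective _ hf, hK.index]
  exists_conjIn L hL := by
    obtain ⟨i, hi⟩ := hK.exists_conjIn _ (hL.map hp hf)
    refine ⟨i, ?_⟩
    rw [← hL.comap_map hp hf hker]
    exact hi.comap hf
  eq_of_conjIn i j h := by
    refine hK.eq_of_conjIn i j ?_
    rw [← Subgroup.map_comap_eq_self_of_surjective hf (K i),
      ← Subgroup.map_comap_eq_self_of_surjective hf (K j)]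
    exact h.map f
  mem_of_map_conj i g h := by
    rw [← comap_conj] at h
    exact hK.mem_of_map_conj i _ (Subgroup.comap_injective hf h)

theorem of_comap [Finite H'] {f : H' →* H}
    (hf : Function.Surjective f) (hker : (Nat.card f.ker).Coprime p)
    (hK : IsComplSystem p k fun i => (K i).comap f) : IsComplSystem p k K where
  isPComplement i := (isPComplement_comap_iff hf hker).1 (hK.isPComplement i)
  index i := by rw [← hK.index i, Subgroup.index_comap_of_surjective _ hf]
  exists_conjIn L hL := by
    obtain ⟨i, hi⟩ := hK.exists_conjIn _ ((isPComplement_comap_iff hf hker).2 hL)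
    refine ⟨i, ?_⟩
    rw [← Subgroup.map_comap_eq_self_of_surjective hf (K i),
      ← Subgroup.map_comap_eq_self_of_surjective hf L]
    exact hi.map f
  eq_of_conjIn i j h := hK.eq_of_conjIn i j (h.comap hf)
  mem_of_map_conj i g h := by
    obtain ⟨g, rfl⟩ := hf g
    refine hK.mem_of_map_conj i g ?_
    rw [← comap_conj, h]

theorem autConj_all (h : AutConj (K 0) (K 1)) (i j : Fin 2) :
    AutConj (K i) (K j) := by
  fin_cases i <;> fin_cases j
  exacts [AutConj.refl _, h, h.symm, AutConj.refl _]

/-- The number of conjugates of `K i` is `p ^ k`. -/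
theorem ncard_conj (hK : IsComplSystem p k K) (i : Fin 2) :
    Set.ncard {L | ConjIn (K i) L} = p ^ k := by
  rw [← hK.index i, Subgroup.index]
  refine (Nat.card_congr (Equiv.ofBijective (fun x : H ⧸ K i => Quotient.liftOn' x
    (fun g => (⟨_, g, rfl⟩ : {L | ConjIn (K i) L})) ?_) ⟨?_, ?_⟩)).symm
  · intro a b hab
    rw [QuotientGroup.leftRel_apply] at hab
    ext x
    simp only [mem_map_conj]
    have : b⁻¹ * x * b = (a⁻¹ * b)⁻¹ * (a⁻¹ * x * a) * (a⁻¹ * b) := by group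
    rw [this, (K i).mul_mem_cancel_right hab, (K i).mul_mem_cancel_left ((K i).inv_mem hab)]
  -- Injectivity on cosets is self-normalisation.
  · intro x y
    induction x using Quotient.inductionOn' with
    | _ a =>
    induction y using Quotient.inductionOn' with
    | _ b =>
    intro h
    refine Quotient.sound' (QuotientGroup.leftRel_apply.2 (hK.mem_of_map_conj i _ ?_))
    have h' := Subtype.ext_iff.1 h
    simp only [Quotient.liftOn'_mk''] at h'
    ext x
    have := SetLike.ext_iff.1 h' (a * x * a⁻¹)
    simp only [mem_map_conj] at this ⊢
    simpa [mul_assoc] using this.symm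
  · rintro ⟨L, g, rfl⟩
    exact ⟨Quotient.mk'' g, rfl⟩

end IsComplSystem

/-! ### Cartesian powers -/

section Powers

variable {p k : ℕ} {H : Type*} [Group H] {ι : Type*}

theorem pi_univ_injective :
    Function.Injective fun L : ι → Subgroup H => Subgroup.pi Set.univ L := by
  classical
  intro L M h
  have key : ∀ L M : ι → Subgroup H, Subgroup.pi Set.univ L ≤ Subgroup.pi Set.univ M → L ≤ M := by
    intro L M h i x hx
    have h1 : Pi.mulSingle i x ∈ Subgroup.pi Set.univ L :=
      (Subgroup.mulSingle_mem_pi (f := fun _ => H) i x).2 fun _ => hx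
    exact (Subgroup.mulSingle_mem_pi (f := fun _ => H) i x).1 (h h1) trivial
  exact le_antisymm (key _ _ h.le) (key _ _ h.ge)

/-- A product of subgroups is isomorphic to the product of the groups. -/
def piMulEquiv (L : ι → Subgroup H) : Subgroup.pi Set.univ L ≃* ∀ i, L i where
  toFun x i := ⟨x.1 i, x.2 i trivial⟩
  invFun x := ⟨fun i => x i, fun i _ => (x i).2⟩
  left_inv _ := rfl
  right_inv _ := rfl
  map_mul' _ _ := rfl

theorem map_conj_pi (L : ι → Subgroup H) (g : ι → H) :
    (Subgroup.pi Set.univ L).map (MulAut.conj g).toMonoidHom =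
      Subgroup.pi Set.univ fun i => (L i).map (MulAut.conj (g i)).toMonoidHom := by
  ext x
  simp only [mem_map_conj, Subgroup.mem_pi]
  rfl

theorem conjIn_pi_iff (L M : ι → Subgroup H) :
    ConjIn (Subgroup.pi Set.univ L) (Subgroup.pi Set.univ M) ↔ ∀ i, ConjIn (L i) (M i) := by
  constructor
  · rintro ⟨g, h⟩ i
    rw [map_conj_pi] at h
    exact ⟨g i, congrFun (pi_univ_injective h) i⟩
  · intro h
    choose g hg using h
    exact ⟨g, by rw [map_conj_pi, funext hg]⟩

theorem autConj_pi {L M : ι → Subgroup H} (h : ∀ i, AutConj (L i) (M i)) :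
    AutConj (Subgroup.pi Set.univ L) (Subgroup.pi Set.univ M) := by
  choose α hα using h
  refine ⟨MulEquiv.piCongrRight α, ?_⟩
  ext x
  simp only [← hα, Subgroup.mem_map, Subgroup.mem_pi]
  constructor
  · rintro ⟨y, hy, rfl⟩ i _
    exact ⟨y i, hy i trivial, rfl⟩
  · intro hx
    choose y hy hxy using fun i => hx i trivial
    exact ⟨y, fun i _ => hy i, funext hxy⟩

variable [Finite ι]

theorem isPComplement_pi {L : ι → Subgroup H} (h : ∀ i, IsPComplement p (L i)) :
    IsPComplement p (Subgroup.pi Set.univ L) := by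
  have := Fintype.ofFinite ι
  choose n hn using fun i => (h i).1
  refine ⟨⟨∑ i, n i, ?_⟩, ?_⟩
  · rw [Subgroup.index_pi, Finset.prod_congr rfl fun i _ => hn i, Finset.prod_pow_eq_pow_sum]
  · rw [Nat.card_congr (piMulEquiv L).toEquiv, Nat.card_pi]
    exact Nat.Coprime.prod_left fun i _ => (h i).2

/-- A `p`-complement in a power of `H` is the product of its projections. -/
theorem IsPComplement.exists_eq_pi (hp : p.Prime) {K : Subgroup (ι → H)}
    (hK : IsPComplement p K) :
    ∃ L : ι → Subgroup H, (∀ i, IsPComplement p (L i)) ∧ K = Subgroup.pi Set.univ L := by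
  have h : ∀ i, IsPComplement p (K.map (Pi.evalMonoidHom (fun _ => H) i)) :=
    fun i => hK.map hp (Function.surjective_eval i)
  -- The product of the projections is a `p`-complement containing `K`, so it equals `K`.
  refine ⟨_, h, hK.eq_of_le (isPComplement_pi h) fun x hx i _ => ⟨x, hx, rfl⟩⟩

variable {K : Fin 2 → Subgroup H}

theorem isPComplement_powSub (hK : IsComplSystem p k K) (φ : ι → Fin 2) :
    IsPComplement p (powSub K φ) :=
  isPComplement_pi fun i => hK.isPComplement (φ i)

omit [Finite ι] in
theorem eq_of_conjIn_powSub (hK : IsComplSystem p k K) {φ ψ : ι → Fin 2}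
    (h : ConjIn (powSub K φ) (powSub K ψ)) : φ = ψ :=
  funext fun i => hK.eq_of_conjIn _ _ ((conjIn_pi_iff _ _).1 h i)

theorem exists_conjIn_powSub (hp : p.Prime) (hK : IsComplSystem p k K) {L : Subgroup (ι → H)}
    (hL : IsPComplement p L) : ∃ φ : ι → Fin 2, ConjIn (powSub K φ) L := by
  obtain ⟨L, h, rfl⟩ := hL.exists_eq_pi hp
  choose φ hφ using fun i => hK.exists_conjIn _ (h i)
  exact ⟨φ, (conjIn_pi_iff _ _).2 hφ⟩

theorem numConjClasses_pow (hp : p.Prime) (hK : IsComplSystem p k K) (m : ℕ) :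
    numConjClasses p (Fin m → H) = 2 ^ m := by
  rw [numConjClasses, card_quotient_eq _
    (fun φ : Fin m → Fin 2 => ⟨powSub K φ, isPComplement_powSub hK φ⟩)]
  · simp
  · exact fun φ ψ h => eq_of_conjIn_powSub hK h
  · exact fun L => exists_conjIn_powSub hp hK L.2

omit [Finite ι] in
theorem autConj_powSub (h : AutConj (K 0) (K 1))
    (φ ψ : ι → Fin 2) : AutConj (powSub K φ) (powSub K ψ) :=
  autConj_pi fun _ => IsComplSystem.autConj_all h _ _

theorem autConj_of_isPComplement (hp : p.Prime) (hK : IsComplSystem p k K)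
    (h : AutConj (K 0) (K 1)) {L M : Subgroup (ι → H)} (hL : IsPComplement p L)
    (hM : IsPComplement p M) : AutConj L M := by
  obtain ⟨φ, hφ⟩ := exists_conjIn_powSub hp hK hL
  obtain ⟨ψ, hψ⟩ := exists_conjIn_powSub hp hK hM
  exact hφ.symm.autConj.trans ((autConj_powSub h φ ψ).trans hψ.autConj)

end Powers

/-! ### Arithmetic of repunits that are prime powers -/

open Finset

/-- If an odd prime `p` divides `Q - 1`, then no repunit of length `s ≥ 2` in base `Q` is a power
of `p`. -/
theorem geomSum_ne_prime_pow {p Q s a : ℕ} (hp : p.Prime) (hodd : Odd p) (hQ : 2 ≤ Q)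
    (hs : 2 ≤ s) (hd : p ∣ Q - 1) : ∑ i ∈ range s, Q ^ i ≠ p ^ a := by
  intro h
  have : Fact p.Prime := ⟨hp⟩
  have hpQ : ¬ p ∣ Q := fun h' => hp.one_lt.ne'
    (Nat.dvd_one.1 ((Nat.dvd_sub_iff_right (by omega) h').1 hd))
  -- Lifting the exponent gives `a = v_p(s)`, so `p ^ a ≤ s`; but a repunit of length `s ≥ 2`
  -- exceeds `s`.
  have h1 := padicValNat.pow_sub_pow (p := p) hodd (show 1 < Q by omega) hd hpQ
    (show s ≠ 0 by omega)
  have h2 : (∑ i ∈ range s, Q ^ i) * (Q - 1) = Q ^ s - 1 := by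
    have := Nat.geomSum_eq hQ s
    rw [this, Nat.div_mul_cancel (by simpa using Nat.sub_dvd_pow_sub_pow Q 1 s)]
  rw [one_pow, ← h2, h, padicValNat.mul (pow_ne_zero _ hp.ne_zero) (by omega),
    padicValNat.prime_pow, add_comm, Nat.add_left_cancel_iff] at h1
  have h3 : p ^ a ≤ s := by
    rw [h1]
    exact Nat.le_of_dvd (by omega) pow_padicValNat_dvd
  have h4 : s < ∑ i ∈ range s, Q ^ i := by
    obtain ⟨t, rfl⟩ : ∃ t, s = t + 2 := ⟨s - 2, by omega⟩
    rw [Finset.sum_range_succ]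
    have : ∑ i ∈ range (t + 1), 1 ≤ ∑ i ∈ range (t + 1), Q ^ i :=
      sum_le_sum fun i _ => Nat.one_le_pow _ _ (by omega)
    have h5 : Q ^ 1 ≤ Q ^ (t + 1) := Nat.pow_le_pow_right (by omega) (by omega)
    rw [pow_one] at h5
    simp at this
    omega
  omega

/-- A repunit of length at least `3` in an odd base is not a power of `2`. -/
theorem geomSum_ne_two_pow {q d a : ℕ} (hq : 2 ≤ q) (hodd : Odd q) (hd : 3 ≤ d) :
    ∑ i ∈ range d, q ^ i ≠ 2 ^ a := by
  have key : ∀ s : ℕ, Even (∑ i ∈ range s, q ^ i) ↔ Even s := by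
    intro s
    rw [← Nat.not_odd_iff_even, Finset.odd_sum_iff_odd_card_odd, ← Nat.not_odd_iff_even]
    simp [hodd.pow]
  have gt : ∀ s : ℕ, 2 ≤ s → 1 < ∑ i ∈ range s, q ^ i := by
    intro s hs
    obtain ⟨t, rfl⟩ : ∃ t, s = t + 2 := ⟨s - 2, by omega⟩
    rw [Finset.sum_range_succ, Finset.sum_range_succ']
    have h5 : 0 < q ^ (t + 1) := Nat.pow_pos (by omega)
    simp
    omega
  have even_of : ∀ x b : ℕ, 1 < x → x = 2 ^ b → Even x := by
    rintro x b hx rfl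
    refine (Nat.even_pow.2 ⟨even_two, ?_⟩)
    rintro rfl
    simp at hx
  intro h
  -- The repunit is even, so `d = 2c` and it splits as (repunit of length `c`) times `1 + q ^ c`,
  -- both powers of `2`. The first factor is even, so `c` is even, `q ^ c` is an odd square, and `1
  -- + q ^ c` is `2` modulo `4` although it is a power of `2` above `2`.
  have h1 := (key d).1 (even_of _ _ (gt d (by omega)) h)
  obtain ⟨c, rfl⟩ := h1
  have h2 : (∑ i ∈ range c, q ^ i) * (1 + q ^ c) = 2 ^ a := by
    rw [← h, Finset.sum_range_add, mul_add, mul_one, Finset.sum_mul]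
    congr 1
    exact sum_congr rfl fun i _ => by rw [pow_add, mul_comm]
  obtain ⟨b, -, hb⟩ := (Nat.dvd_prime_pow Nat.prime_two).1 (Dvd.intro _ h2)
  obtain ⟨b', -, hb'⟩ := (Nat.dvd_prime_pow Nat.prime_two).1 (Dvd.intro_left _ h2)
  obtain ⟨c', rfl⟩ := (key c).1 (even_of _ _ (gt c (by omega)) hb)
  obtain ⟨x, hx⟩ := hodd.pow (n := c')
  have h3 : 2 < 1 + q ^ (c' + c') := by
    have : q ^ 1 ≤ q ^ (c' + c') := Nat.pow_le_pow_right (by omega) (by omega)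
    rw [pow_one] at this
    omega
  have h4 : 1 < b' := by
    by_contra h
    have : 2 ^ b' ≤ 2 ^ 1 := Nat.pow_le_pow_right (by omega) (by omega)
    rw [pow_one] at this
    omega
  have h5 : 4 ∣ 1 + q ^ (c' + c') := by
    rw [hb']
    exact pow_dvd_pow 2 h4
  rw [pow_add, hx] at h5
  ring_nf at h5
  omega

variable {p q d k : ℕ}

/-- If the repunit `(q ^ d - 1) / (q - 1)`, where `d ≥ 3`, is a power of the prime `p`, then `q` has
order `d` modulo `p`. -/
theorem not_dvd_pow_sub_one (hp : p.Prime) (hq : 2 ≤ q) (hd : 3 ≤ d)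
    (h : p ^ k * (q - 1) = q ^ d - 1) {j : ℕ} (hj : 0 < j) (hjd : j < d) : ¬ p ∣ q ^ j - 1 := by
  intro hdvd
  have geom : ∀ Q s : ℕ, 2 ≤ Q → (∑ i ∈ range s, Q ^ i) * (Q - 1) = Q ^ s - 1 := by
    intro Q s hQ
    rw [Nat.geomSum_eq hQ s, Nat.div_mul_cancel (by simpa using Nat.sub_dvd_pow_sub_pow Q 1 s)]
  have hk : ∑ i ∈ range d, q ^ i = p ^ k :=
    Nat.eq_of_mul_eq_mul_right (show 0 < q - 1 by omega) (by rw [geom q d hq, h])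
  have hk0 : k ≠ 0 := by
    rintro rfl
    have : q ^ 1 < q ^ d := Nat.pow_lt_pow_right (by omega) (by omega)
    rw [pow_zero, one_mul] at h
    rw [pow_one] at this
    omega
  have hpq : ¬ p ∣ q := fun h' => by
    have h1 : p ∣ q ^ j := dvd_pow h' hj.ne'
    exact hp.one_lt.ne' (Nat.dvd_one.1 ((Nat.dvd_sub_iff_right (Nat.one_le_pow _ _ (by omega))
      h1).1 hdvd))
  rcases hp.eq_two_or_odd' with rfl | hodd
  · exact geomSum_ne_two_pow hq (Nat.not_even_iff_odd.1 fun h => hpq h.two_dvd) hd hk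
  -- Here `n = gcd(j, d)` is a proper divisor of `d = n * s`. The repunit of length `s ≥ 2` in base
  -- `q ^ n` divides `p ^ k`, hence is a power of `p`, while `p` divides `q ^ n - 1`.
  · have hn : p ∣ q ^ (j.gcd d) - 1 := by
      rw [← Nat.pow_sub_one_gcd_pow_sub_one]
      exact Nat.dvd_gcd hdvd (h ▸ Dvd.dvd.mul_right (dvd_pow_self p hk0) _)
    obtain ⟨s, hs⟩ := Nat.gcd_dvd_right j d
    have hn0 : 0 < j.gcd d := Nat.gcd_pos_of_pos_left _ hj
    have hnj : j.gcd d ≤ j := Nat.gcd_le_left _ hj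
    generalize j.gcd d = n at *
    have hs2 : 2 ≤ s := by
      by_contra hs2
      have : n * s ≤ n * 1 := Nat.mul_le_mul_left _ (by omega)
      omega
    have hQ : 2 ≤ q ^ n := hq.trans (Nat.le_self_pow hn0.ne' q)
    have h2 : (∑ i ∈ range s, (q ^ n) ^ i) ∣ p ^ k := by
      refine ⟨∑ i ∈ range n, q ^ i, Nat.eq_of_mul_eq_mul_right (show 0 < q - 1 by omega) ?_⟩
      rw [h, mul_assoc, geom q n hq, geom _ s hQ, hs, pow_mul]
    obtain ⟨a, -, ha⟩ := (Nat.dvd_prime_pow hp).1 h2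
    exact geomSum_ne_prime_pow hp hodd hQ hs2 hn ha

theorem not_dvd_base (hp : p.Prime) (hq : 2 ≤ q) (hd : 3 ≤ d) (hk : 1 ≤ k)
    (h : p ^ k * (q - 1) = q ^ d - 1) : ¬ p ∣ q := fun h' => by
  have h1 : p ∣ q ^ d := dvd_pow h' (by omega)
  have h2 : p ∣ q ^ d - 1 := h ▸ Dvd.dvd.mul_right (dvd_pow_self p (by omega)) _
  exact hp.one_lt.ne' (Nat.dvd_one.1 ((Nat.dvd_sub_iff_right (Nat.one_le_pow _ _ (by omega))
      h1).1 h2))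

/-- The order of `GL_d(q)` is the product of `p ^ k = (q ^ d - 1) / (q - 1)` and a number prime
to `p`. -/
theorem exists_prod_eq_mul (hp : p.Prime) (hq : 2 ≤ q) (hd : 3 ≤ d) (hk : 1 ≤ k)
    (h : p ^ k * (q - 1) = q ^ d - 1) :
    ∃ M : ℕ, M.Coprime p ∧ ∏ i : Fin d, (q ^ d - q ^ (i : ℕ)) = p ^ k * M := by
  obtain ⟨t, rfl⟩ : ∃ t, d = t + 1 := ⟨d - 1, by omega⟩
  have hpq := not_dvd_base hp hq hd hk h
  -- The factor `i = 0` is `q ^ d - 1 = p ^ k * (q - 1)`; every other one is a power of `q` times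
  -- some `q ^ j - 1` with `0 < j < d`.
  refine ⟨(q - 1) * ∏ i : Fin t, (q ^ (t + 1) - q ^ (i + 1 : ℕ)), ?_, ?_⟩
  · refine Nat.Coprime.mul_left ?_ (Nat.Coprime.prod_left fun i _ => ?_)
    · exact ((Nat.Prime.coprime_iff_not_dvd hp).2
        (by simpa using not_dvd_pow_sub_one hp hq hd h one_pos (by omega))).symm
    · have : q ^ (t + 1) - q ^ (i + 1 : ℕ) = q ^ (i + 1 : ℕ) * (q ^ (t - i) - 1) := by
        rw [Nat.mul_sub, ← pow_add, mul_one]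
        congr 2
        omega
      rw [this]
      refine (Nat.Coprime.mul_left (Nat.Coprime.pow_left _ ?_) ?_)
      · exact ((Nat.Prime.coprime_iff_not_dvd hp).2 hpq).symm
      · exact ((Nat.Prime.coprime_iff_not_dvd hp).2
          (not_dvd_pow_sub_one hp hq hd h (by omega) (by omega))).symm
  · rw [Fin.prod_univ_succ, ← mul_assoc, h]
    simp

/-! ### Transvections and stabilisers of subspaces -/

section Unipotent

variable {F V : Type*} [Field F] [AddCommGroup V] [Module F V]

/-- The unipotent map `1 + N`, where `N ^ 2 = 0`; its order divides the characteristic. -/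
theorem exists_unipotent (N : V →ₗ[F] V) (hN : ∀ x, N (N x) = 0) :
    ∃ g : V ≃ₗ[F] V, g ^ ringChar F = 1 ∧ ∀ x, g x = x + N x := by
  let g : V ≃ₗ[F] V := LinearEquiv.ofLinearMap (LinearMap.id + N) (LinearMap.id - N)
    (by ext x; simp [hN]) (by ext x; simp [hN])
  have hg : ∀ x, g x = x + N x := fun x => rfl
  have hpow : ∀ (n : ℕ) x, (g ^ n) x = x + n • N x := by
    intro n
    induction n with
    | zero => simp
    | succ n ih =>
      intro x
      rw [pow_succ', LinearEquiv.mul_apply, ih, hg, map_add, map_nsmul, hN, smul_zero, add_zero,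
        succ_nsmul]
      abel
  refine ⟨g, ?_, hg⟩
  ext x
  rw [hpow, ← Nat.cast_smul_eq_nsmul F, ringChar.Nat.cast_ringChar, zero_smul, add_zero]
  rfl

theorem exists_transvection (f : Module.Dual F V) (u : V) (h : f u = 0) :
    ∃ g : V ≃ₗ[F] V, g ^ ringChar F = 1 ∧ ∀ x, g x = x + f x • u := by
  obtain ⟨g, h1, h2⟩ := exists_unipotent (f.smulRight u) (by simp [h])
  exact ⟨g, h1, h2⟩

theorem exists_dual_eq_one {W : Submodule F V} {x : V} (h : x ∉ W) :
    ∃ f : Module.Dual F V, f x = 1 ∧ ∀ w ∈ W, f w = 0 := by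
  obtain ⟨f, h1, h2⟩ := Submodule.exists_le_ker_of_notMem h
  exact ⟨(f x)⁻¹ • f, by simp [h1], fun w hw => by simp [LinearMap.mem_ker.1 (h2 hw)]⟩

theorem mem_linStab_iff {d : ℕ} {U : Submodule F (Fin d → F)}
    {g : (Fin d → F) ≃ₗ[F] (Fin d → F)} : g ∈ linStab U ↔ ∀ x, x ∈ U ↔ g x ∈ U := by
  constructor
  · intro h x
    change U.map g.toLinearMap = U at h
    constructor
    · intro hx
      rw [← h]
      exact ⟨x, hx, rfl⟩
    · intro hx
      rw [← h] at hx
      obtain ⟨y, hy, hxy⟩ := hx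
      exact g.injective hxy ▸ hy
  · intro h
    change U.map g.toLinearMap = U
    ext x
    constructor
    · rintro ⟨y, hy, rfl⟩
      exact (h y).1 hy
    · intro hx
      exact ⟨g.symm x, (h _).2 (by simpa using hx), by simp⟩

theorem mem_linStab_of_le {d : ℕ} [Finite F] {U : Submodule F (Fin d → F)}
    {g : (Fin d → F) ≃ₗ[F] (Fin d → F)} (h : ∀ x ∈ U, g x ∈ U) : g ∈ linStab U := by
  change U.map g.toLinearMap = U
  refine Submodule.eq_of_le_of_finrank_eq ?_ (LinearEquiv.finrank_map_eq g U)
  rintro _ ⟨x, hx, rfl⟩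
  exact h x hx

end Unipotent

/-! ### Linear groups with many transvections -/

section Rep

variable {F : Type*} [Field F] {d : ℕ} {X : Type*} [Group X]

/-- The stabiliser of the subspace `U` in a group acting linearly on `F ^ d`. -/
def repStab (ρ : X →* ((Fin d → F) ≃ₗ[F] (Fin d → F))) (U : Submodule F (Fin d → F)) :
    Subgroup X :=
  (linStab U).comap ρ

/-- A linear group containing all elements whose order divides the characteristic, and with a
duality, such as `SL_d(F)` and `GL_d(F)`. -/
structure IsBigRep (ρ : X →* ((Fin d → F) ≃ₗ[F] (Fin d → F))) : Prop where
  injective : Function.Injective ρ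
  exists_eq : ∀ g, g ^ ringChar F = 1 → ∃ x, ρ x = g
  exists_dual : ∃ τ : X ≃* X, ∀ x a b, ρ (τ x) a ⬝ᵥ ρ x b = a ⬝ᵥ b

variable {ρ : X →* ((Fin d → F) ≃ₗ[F] (Fin d → F))}

theorem mem_repStab_iff {U : Submodule F (Fin d → F)} {g : X} :
    g ∈ repStab ρ U ↔ ∀ x, x ∈ U ↔ ρ g x ∈ U :=
  mem_linStab_iff

theorem map_conj_repStab (U : Submodule F (Fin d → F)) (g : X) :
    (repStab ρ U).map (MulAut.conj g).toMonoidHom = repStab ρ (U.map (ρ g).toLinearMap) := by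
  have key : ∀ x, x ∈ U.map (ρ g).toLinearMap ↔ ρ g⁻¹ x ∈ U := by
    intro x
    rw [map_inv]
    exact Submodule.mem_map_equiv (e := ρ g) U
  ext x
  rw [mem_map_conj, mem_repStab_iff, mem_repStab_iff]
  simp only [key]
  simp only [map_mul, LinearEquiv.mul_apply]
  refine ⟨fun h y => ?_, fun h y => ?_⟩
  · have := h (ρ g⁻¹ y)
    rwa [← LinearEquiv.mul_apply (ρ g), ← map_mul, mul_inv_cancel, map_one] at this
  · have := h (ρ g y)
    rwa [← LinearEquiv.mul_apply (ρ g⁻¹), ← map_mul, inv_mul_cancel, map_one] at this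

/-- The stabiliser of a proper nonzero subspace stabilises no other such subspace. -/
theorem eq_of_repStab_le [Finite F] (hρ : IsBigRep ρ) {W W' : Submodule F (Fin d → F)}
    (hW' : W' ≠ ⊥) (hW'' : W' ≠ ⊤) (h : repStab ρ W ≤ repStab ρ W') : W = W' := by
  have key : ∀ (f : Module.Dual F (Fin d → F)) u, f u = 0 → (∀ x ∈ W, x + f x • u ∈ W) →
      ∀ x ∈ W', x + f x • u ∈ W' := by
    intro f u hfu hx
    obtain ⟨g, h1, h2⟩ := exists_transvection f u hfu
    obtain ⟨y, rfl⟩ := hρ.exists_eq g h1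
    intro x
    have h3 : y ∈ repStab ρ W := mem_linStab_of_le (by simpa only [h2] using hx)
    rw [← h2]
    exact (mem_repStab_iff.1 (h h3) x).1
  -- Given `w ∈ W'` outside `W`, take `f` vanishing on `W` with `f w = 1`. The transvections `x + f
  -- x • u`, `f u = 0`, fix `W` pointwise and move `w` by `u`, so `W'` contains the kernel of `f` as
  -- well as `w`.
  have hle : W' ≤ W := by
    intro w hw
    by_contra hwW
    obtain ⟨f, hf1, hf⟩ := exists_dual_eq_one hwW
    refine hW'' (eq_top_iff.2 fun x _ => ?_)
    have hu : ∀ u, f u = 0 → u ∈ W' := by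
      intro u hu
      have := key f u hu (fun x hx => by simpa [hf x hx] using hx) w hw
      rwa [hf1, one_smul, W'.add_mem_iff_right hw] at this
    have := hu (x - f x • w) (by simp [hf1])
    rwa [W'.sub_mem_iff_left (W'.smul_mem _ hw)] at this
  -- A transvection with centre `w ∈ W` preserves `W`; chosen to send a nonzero `w' ∈ W'` to `w' +
  -- w`, it forces `w ∈ W'`.
  refine le_antisymm (fun w hw => ?_) hle
  by_contra hwW
  obtain ⟨w', hw', hw0⟩ := W'.exists_mem_ne_zero_of_ne_bot hW'
  have h1 : w' ∉ Submodule.span F {w} := by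
    intro hs
    obtain ⟨c, rfl⟩ := Submodule.mem_span_singleton.1 hs
    have hc : c ≠ 0 := fun hc => hw0 (by simp [hc])
    exact hwW ((W'.smul_mem_iff hc).1 hw')
  obtain ⟨f, hf1, hf⟩ := exists_dual_eq_one h1
  have := key f w (hf w (Submodule.mem_span_singleton_self w))
    (fun x hx => W.add_mem hx (W.smul_mem _ hw)) w' hw'
  rw [hf1, one_smul, W'.add_mem_iff_right hw'] at this
  exact hwW this

/-- The group is transitive on lines. -/
theorem exists_apply_eq_smul (hρ : IsBigRep ρ) {x y : Fin d → F} (hx : x ≠ 0) (hy : y ≠ 0) :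
    ∃ g : X, ∃ c : F, c ≠ 0 ∧ y = c • ρ g x := by
  by_cases h : y ∈ Submodule.span F {x}
  · obtain ⟨c, rfl⟩ := Submodule.mem_span_singleton.1 h
    exact ⟨1, c, fun hc => hy (by simp [hc]), by simp⟩
  -- For independent `x`, `y` a transvection with centre `y - x` takes `x` to `y`.
  · have h1 : x ∉ Submodule.span F {y - x} := by
      intro hs
      obtain ⟨c, hc⟩ := Submodule.mem_span_singleton.1 hs
      have hc0 : c ≠ 0 := fun hc0 => hx (by rw [← hc, hc0, zero_smul])
      refine h (Submodule.mem_span_singleton.2 ⟨c⁻¹ * (1 + c), ?_⟩)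
      have : (1 + c) • x = c • y := by
        rw [add_smul, one_smul]
        nth_rewrite 1 [← hc]
        rw [smul_sub]
        abel
      rw [mul_smul, this, inv_smul_smul₀ hc0]
    obtain ⟨f, hf1, hf⟩ := exists_dual_eq_one h1
    obtain ⟨g, h1, h2⟩ := exists_transvection f (y - x)
      (hf _ (Submodule.mem_span_singleton_self _))
    obtain ⟨g, rfl⟩ := hρ.exists_eq g h1
    exact ⟨g, 1, one_ne_zero, by simp [h2, hf1]⟩

end Rep

/-! ### Counting orbits and images of subspaces -/

section Classification

variable {F : Type*} [Field F] {d : ℕ} {X : Type*} [Group X]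
  {ρ : X →* ((Fin d → F) ≃ₗ[F] (Fin d → F))}

/-- Orbit-stabiliser on the lines. Only transitivity is assumed, so that the lemma also applies to
`ρ` restricted to a subgroup, which need not be a big representation. -/
theorem index_repStab_span (v : Fin d → F) (hv : v ≠ 0)
    (h : ∀ x ≠ 0, ∃ g : X, ∃ c : F, c ≠ 0 ∧ x = c • ρ g v) :
    (repStab ρ (Submodule.span F {v})).index = Nat.card (Projectivization F (Fin d → F)) := by
  let _ : MulAction X (Submodule F (Fin d → F)) :=
    { smul g U := U.map (ρ g).toLinearMap
      one_smul U := by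
        change U.map (ρ 1).toLinearMap = U
        rw [map_one]
        exact Submodule.map_id U
      mul_smul g g' U := by
        change U.map (ρ (g * g')).toLinearMap = (U.map (ρ g').toLinearMap).map (ρ g).toLinearMap
        rw [map_mul, ← Submodule.map_comp]
        rfl }
  have hsmul : ∀ (g : X) (U : Submodule F (Fin d → F)), g • U = U.map (ρ g).toLinearMap :=
    fun _ _ => rfl
  have h1 : repStab ρ (Submodule.span F {v}) = MulAction.stabilizer X (Submodule.span F {v}) :=
    rfl
  rw [h1, MulAction.index_stabilizer, Nat.card_congr (Projectivization.equivSubmodule F _)]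
  change _ = Set.ncard {H : Submodule F (Fin d → F) | Module.finrank F H = 1}
  congr 1
  ext U
  simp only [Set.mem_ofPred_eq, MulAction.mem_orbit_iff, hsmul]
  constructor
  · rintro ⟨g, rfl⟩
    rw [LinearEquiv.finrank_map_eq (ρ g), finrank_span_singleton hv]
  · intro hU
    obtain ⟨x, hx, hx'⟩ := finrank_eq_one_iff'.1 hU
    obtain ⟨g, c, hc, hgc⟩ := h x (by simpa using hx)
    have hxU : U = Submodule.span F {(x : Fin d → F)} := by
      refine le_antisymm (fun w hw => ?_) (by simp)
      obtain ⟨a, ha⟩ := hx' ⟨w, hw⟩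
      exact Submodule.mem_span_singleton.2 ⟨a, congrArg Subtype.val ha⟩
    refine ⟨g, ?_⟩
    rw [hxU, hgc, Submodule.map_span, Set.image_singleton,
      Submodule.span_singleton_smul_eq (IsUnit.mk0 c hc)]
    rfl

/-- The group of transvections with centre `v`. -/
def transvectionGroup (ρ : X →* ((Fin d → F) ≃ₗ[F] (Fin d → F))) (v : Fin d → F) :
    Subgroup X where
  carrier := {g | ∃ f : Module.Dual F (Fin d → F), f v = 0 ∧ ∀ x, ρ g x = x + f x • v}
  one_mem' := ⟨0, by simp⟩
  mul_mem' := by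
    rintro a b ⟨f, hf, hfa⟩ ⟨f', hf', hfb⟩
    refine ⟨f + f', by simp [hf, hf'], fun x => ?_⟩
    rw [map_mul, LinearEquiv.mul_apply, hfa, hfb, map_add, map_smul, hf, LinearMap.add_apply]
    module
  inv_mem' := by
    rintro a ⟨f, hf, hfa⟩
    refine ⟨-f, by simp [hf], fun x => ?_⟩
    rw [map_inv]
    refine (LinearEquiv.symm_apply_eq (ρ a)).2 ?_
    rw [hfa, map_add, map_smul]
    simp [hf]

theorem isPGroup_transvectionGroup (hρ : IsBigRep ρ) (v : Fin d → F) :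
    IsPGroup (ringChar F) (transvectionGroup ρ v) := by
  rintro ⟨g, f, hf, hg⟩
  refine ⟨1, Subtype.ext (hρ.injective ?_)⟩
  obtain ⟨g', h1, h2⟩ := exists_transvection f v hf
  have : ρ g = g' := by
    ext1 x
    rw [hg, h2]
  simp [this, h1]

/-- A subgroup containing the transvections with centre `v` leaves invariant the subspace that
consists of the lines in the orbit of `v`. -/
theorem exists_invariant_subspace (hρ : IsBigRep ρ) {v : Fin d → F} {K : Subgroup X}
    (hK : transvectionGroup ρ v ≤ K) :
    ∃ W : Submodule F (Fin d → F), (∀ x, x ∈ W ↔ ∃ g ∈ K, ∃ c : F, x = c • ρ g v) ∧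
      K ≤ repStab ρ W := by
  -- Conjugating by `g ∈ K` moves the centre from `v` to `ρ g v`, so `K` contains all transvections
  -- centred at points of the orbit.
  have key : ∀ g ∈ K, ∀ (f : Module.Dual F (Fin d → F)), f (ρ g v) = 0 →
      ∃ t ∈ K, ∀ x, ρ t x = x + f x • ρ g v := by
    intro g hg f hf
    obtain ⟨t, h1, h2⟩ := exists_transvection (f ∘ₗ (ρ g).toLinearMap) v hf
    obtain ⟨t, rfl⟩ := hρ.exists_eq t h1
    refine ⟨g * t * g⁻¹, K.mul_mem (K.mul_mem hg (hK ⟨_, hf, h2⟩)) (K.inv_mem hg), fun x => ?_⟩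
    have hinv : ρ g (ρ g⁻¹ x) = x := by
      rw [← LinearEquiv.mul_apply, ← map_mul, mul_inv_cancel, map_one]
      rfl
    rw [map_mul, map_mul, LinearEquiv.mul_apply, LinearEquiv.mul_apply, h2, map_add, map_smul]
    simp [hinv, -map_inv]
  let W : Submodule F (Fin d → F) :=
    { carrier := {x | ∃ g ∈ K, ∃ c : F, x = c • ρ g v}
      zero_mem' := ⟨1, K.one_mem, 0, by simp⟩
      smul_mem' := by
        rintro a _ ⟨g, hg, c, rfl⟩
        exact ⟨g, hg, a * c, by rw [mul_smul]⟩
      add_mem' := by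
        rintro _ y ⟨g, hg, c, rfl⟩ ⟨h, hh, c', hy⟩
        by_cases hyg : y ∈ Submodule.span F {ρ g v}
        · obtain ⟨a, rfl⟩ := Submodule.mem_span_singleton.1 hyg
          exact ⟨g, hg, c + a, by rw [add_smul]⟩
        -- If `y` is off the line of `ρ g v`, a transvection in `K` with this centre takes `y` to `y
        -- + c • ρ g v`, which therefore lies on a line of the orbit.
        · obtain ⟨f, hf1, hf⟩ := exists_dual_eq_one hyg
          obtain ⟨t, ht, htx⟩ := key g hg (c • f)
            (by simp [hf _ (Submodule.mem_span_singleton_self _)])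
          refine ⟨t * h, K.mul_mem ht hh, c', ?_⟩
          rw [map_mul, LinearEquiv.mul_apply, ← map_smul (ρ t), ← hy, htx]
          simp [hf1, add_comm] }
  have hW : ∀ x, x ∈ W ↔ ∃ g ∈ K, ∃ c : F, x = c • ρ g v := fun x => Iff.rfl
  refine ⟨W, hW, fun g hg => mem_repStab_iff.2 fun x => ⟨?_, ?_⟩⟩
  · rintro ⟨h, hh, c, rfl⟩
    exact ⟨g * h, K.mul_mem hg hh, c, by simp⟩
  · rintro ⟨h, hh, c, hc⟩
    refine ⟨g⁻¹ * h, K.mul_mem (K.inv_mem hg) hh, c, (ρ g).injective ?_⟩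
    rw [hc, map_smul, ← LinearEquiv.mul_apply, ← map_mul, mul_inv_cancel_left]

variable [Finite F] [Finite X]

/-- A lower bound for the number of images of a subspace. -/
theorem pow_le_index_repStab (hρ : IsBigRep ρ) (W : Submodule F (Fin d → F)) :
    Nat.card F ^ (Module.finrank F W * (d - Module.finrank F W)) ≤ (repStab ρ W).index := by
  obtain ⟨W', hW'⟩ := W.exists_isCompl
  have hfin : Module.finrank F W + Module.finrank F W' = d := by
    rw [Submodule.finrank_add_eq_of_isCompl hW', Module.finrank_fin_fun]
  -- The map `1 + N f` sends `W` to the graph of `f : W → W'`. Distinct `f` have distinct graphs, so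
  -- they give distinct cosets of the stabiliser of `W`.
  let N : (W →ₗ[F] W') →ₗ[F] ((Fin d → F) →ₗ[F] (Fin d → F)) :=
    { toFun f := W'.subtype ∘ₗ f ∘ₗ W.projectionOnto W' hW'
      map_add' f g := by ext; simp
      map_smul' c f := by ext; simp }
  have hNW : ∀ f (w : W), N f w = f w := by
    intro f w
    simp [N]
  have hN : ∀ f f' x, N f (N f' x) = 0 := by
    intro f f' x
    simp [N]
  choose g hg1 hg using fun f => exists_unipotent (N f) (hN f f)
  choose x hx using fun f => hρ.exists_eq (g f) (hg1 f)
  have hinj : Function.Injective fun f => (x f : X ⧸ repStab ρ W) := by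
    intro f f' h
    have h1 := mem_repStab_iff.1 (QuotientGroup.eq.1 h)
    ext w
    have h2 : ρ ((x f)⁻¹ * x f') w = w + N (f' - f) w := by
      apply (ρ (x f)).injective
      rw [← LinearEquiv.mul_apply, ← map_mul, mul_inv_cancel_left, hx, hx, hg, hg]
      rw [map_sub N, LinearMap.sub_apply, map_add, map_sub, hN, hN]
      abel
    have h3 := (h1 w).1 w.2
    rw [h2, W.add_mem_iff_right w.2, hNW] at h3
    have h4 := Submodule.disjoint_def.1 hW'.disjoint _ h3 ((f' - f) w).2
    rw [LinearMap.sub_apply, Submodule.coe_sub, sub_eq_zero] at h4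
    rw [h4]
  have h1 := Nat.card_le_card_of_injective _ hinj
  have h2 : Module.finrank F (W →ₗ[F] W') = Module.finrank F W * (d - Module.finrank F W) := by
    rw [Module.finrank_linearMap, ← Nat.eq_sub_of_add_eq' hfin]
  have : Finite (W →ₗ[F] W') := Module.finite_of_finite F
  rw [Module.natCard_eq_pow_finrank (K := F), h2] at h1
  exact h1

end Classification

/-! ### Orthogonal complements and the duality automorphism -/

section Duality

variable {F : Type*} [Field F] {d : ℕ}

theorem nondegenerate_dotProduct :
    LinearMap.BilinForm.Nondegenerate (dotProductBilin (m := Fin d) F F) :=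
  ⟨fun v h => dotProduct_eq_zero v h,
    fun v h => dotProduct_eq_zero v fun w => by rw [dotProduct_comm]; exact h w⟩

/-- The orthogonal complement with respect to the dot product. -/
def perp (U : Submodule F (Fin d → F)) : Submodule F (Fin d → F) :=
  LinearMap.BilinForm.orthogonal (dotProductBilin F F) U

theorem mem_perp {U : Submodule F (Fin d → F)} {x : Fin d → F} :
    x ∈ perp U ↔ ∀ u ∈ U, u ⬝ᵥ x = 0 := Iff.rfl

theorem finrank_perp (U : Submodule F (Fin d → F)) :
    Module.finrank F (perp U) = d - Module.finrank F U := by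
  rw [perp, LinearMap.BilinForm.finrank_orthogonal nondegenerate_dotProduct,
    Module.finrank_fin_fun]

theorem perp_perp (U : Submodule F (Fin d → F)) : perp (perp U) = U :=
  LinearMap.BilinForm.orthogonal_orthogonal nondegenerate_dotProduct
    (fun x y h => (dotProduct_comm y x).trans h) U

variable {X : Type*} [Group X] {ρ : X →* ((Fin d → F) ≃ₗ[F] (Fin d → F))} [Finite F]

/-- As `ρ (τ x)` is adjoint inverse to `ρ x`, it preserves `perp U` exactly when `ρ x` preserves
`U`. -/
theorem map_repStab_of_dual {τ : X ≃* X} (hτ : ∀ x a b, ρ (τ x) a ⬝ᵥ ρ x b = a ⬝ᵥ b)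
    (U : Submodule F (Fin d → F)) :
    (repStab ρ U).map τ.toMonoidHom = repStab ρ (perp U) := by
  apply le_antisymm
  · rintro _ ⟨x, hx, rfl⟩
    refine mem_linStab_of_le fun b hb => mem_perp.2 fun u hu => ?_
    obtain ⟨u, rfl⟩ := (ρ x).surjective u
    rw [dotProduct_comm]
    refine (hτ x b u).trans ?_
    rw [dotProduct_comm]
    exact mem_perp.1 hb u ((mem_repStab_iff.1 hx u).2 hu)
  · intro y hy
    obtain ⟨x, rfl⟩ := τ.surjective y
    refine ⟨x, mem_linStab_of_le fun u hu => ?_, rfl⟩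
    rw [← perp_perp U]
    refine mem_perp.2 fun b hb => ?_
    obtain ⟨b, rfl⟩ := (ρ (τ x)).surjective b
    rw [hτ, dotProduct_comm]
    exact mem_perp.1 ((mem_repStab_iff.1 hy b).2 hb) u hu

end Duality

/-! ### Classification of the `p`-complements of linear groups -/

section Classification

variable {F : Type*} [Field F] {d : ℕ} {X : Type*} [Group X]
  {ρ : X →* ((Fin d → F) ≃ₗ[F] (Fin d → F))} [Finite F] {p k : ℕ}

omit [Finite F] in
theorem eq_span_of_finrank_eq_one {U : Submodule F (Fin d → F)} (hU : Module.finrank F U = 1) :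
    ∃ v, v ≠ 0 ∧ U = Submodule.span F {v} := by
  obtain ⟨x, hx, hx'⟩ := finrank_eq_one_iff'.1 hU
  refine ⟨x, by simpa using hx, le_antisymm (fun w hw => ?_) (by simp)⟩
  obtain ⟨a, ha⟩ := hx' ⟨w, hw⟩
  exact Submodule.mem_span_singleton.2 ⟨a, congrArg Subtype.val ha⟩

/-- Transitivity on lines settles dimension `1`; duality carries it over to hyperplanes. -/
theorem conjIn_repStab (hρ : IsBigRep ρ) (hd : 3 ≤ d) {U U' : Submodule F (Fin d → F)}
    (hU : Module.finrank F U = 1 ∨ Module.finrank F U = d - 1)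
    (h : Module.finrank F U = Module.finrank F U') :
    ConjIn (repStab ρ U) (repStab ρ U') := by
  have key : ∀ U U' : Submodule F (Fin d → F), Module.finrank F U = 1 →
      Module.finrank F U' = 1 → ConjIn (repStab ρ U) (repStab ρ U') := by
    intro U U' hU hU'
    obtain ⟨x, hx, rfl⟩ := eq_span_of_finrank_eq_one hU
    obtain ⟨y, hy, rfl⟩ := eq_span_of_finrank_eq_one hU'
    obtain ⟨g, c, hc, rfl⟩ := exists_apply_eq_smul hρ hx hy
    refine ⟨g, ?_⟩
    rw [map_conj_repStab, Submodule.map_span, Set.image_singleton,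
      Submodule.span_singleton_smul_eq (IsUnit.mk0 c hc)]
    rfl
  rcases hU with hU | hU
  · exact key _ _ hU (h ▸ hU)
  · obtain ⟨τ, hτ⟩ := hρ.exists_dual
    rw [← perp_perp U, ← perp_perp U', ← map_repStab_of_dual hτ (perp U),
      ← map_repStab_of_dual hτ (perp U')]
    have h1 := key (perp U) (perp U') (by rw [finrank_perp]; omega) (by rw [finrank_perp]; omega)
    exact h1.map τ.toMonoidHom

theorem autConj_repStab (hρ : IsBigRep ρ) (hd : 3 ≤ d) {U U' : Submodule F (Fin d → F)}
    (hU : Module.finrank F U = 1) (hU' : Module.finrank F U' = d - 1) :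
    AutConj (repStab ρ U) (repStab ρ U') := by
  obtain ⟨τ, hτ⟩ := hρ.exists_dual
  have h1 : AutConj (repStab ρ U) (repStab ρ (perp U)) := ⟨τ, map_repStab_of_dual hτ U⟩
  have h2 : ConjIn (repStab ρ (perp U)) (repStab ρ U') :=
    conjIn_repStab hρ hd (Or.inr (by rw [finrank_perp, hU])) (by rw [finrank_perp, hU, hU'])
  exact h1.trans h2.autConj

variable (hp : p.Prime) (hd : 3 ≤ d) (hk : 1 ≤ k)
  (h : p ^ k * (Nat.card F - 1) = Nat.card F ^ d - 1)

include h in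
theorem card_projectivization : Nat.card (Projectivization F (Fin d → F)) = p ^ k := by
  have h1 := Projectivization.card F (Fin d → F)
  have h2 : 1 < Nat.card F := Finite.one_lt_card
  rw [Nat.card_fun, Nat.card_fin, ← h] at h1
  exact (Nat.eq_of_mul_eq_mul_right (by omega) h1).symm

variable [Finite X] (hρ : IsBigRep ρ) {M : ℕ} (hM : M.Coprime p) (hX : Nat.card X ∣ p ^ k * M)

omit [Finite X] in
include hd h hρ in
theorem index_repStab {U : Submodule F (Fin d → F)}
    (hU : Module.finrank F U = 1 ∨ Module.finrank F U = d - 1) :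
    (repStab ρ U).index = p ^ k := by
  have key : ∀ U : Submodule F (Fin d → F), Module.finrank F U = 1 →
      (repStab ρ U).index = p ^ k := by
    intro U hU
    obtain ⟨x, hx, rfl⟩ := eq_span_of_finrank_eq_one hU
    rw [index_repStab_span x hx fun y hy => exists_apply_eq_smul hρ hx hy,
      card_projectivization h]
  rcases hU with hU | hU
  · exact key U hU
  · obtain ⟨τ, hτ⟩ := hρ.exists_dual
    rw [← perp_perp U, ← map_repStab_of_dual hτ, ← key (perp U) (by rw [finrank_perp]; omega)]
    exact Subgroup.index_map_equiv _ τ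

omit [Finite X] in
include hp hd h hρ hM hX in
theorem isPComplement_repStab {U : Submodule F (Fin d → F)}
    (hU : Module.finrank F U = 1 ∨ Module.finrank F U = d - 1) :
    IsPComplement p (repStab ρ U) := by
  have h1 := index_repStab hd h hρ hU
  refine ⟨⟨k, h1⟩, ?_⟩
  rw [← (repStab ρ U).card_mul_index, h1, mul_comm] at hX
  exact Nat.Coprime.of_dvd_left (Nat.dvd_of_mul_dvd_mul_left (pow_pos hp.pos k) hX) hM

include hp hd hk h hρ hM hX in
/-- Every `p`-complement is the stabiliser of a line or a hyperplane. -/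
theorem IsPComplement.exists_conjIn_repStab {K : Subgroup X} (hK : IsPComplement p K) :
    ∃ W : Submodule F (Fin d → F), (Module.finrank F W = 1 ∨ Module.finrank F W = d - 1) ∧
      ConjIn (repStab ρ W) K := by
  have hq : 2 ≤ Nat.card F := Finite.one_lt_card
  have hpq := not_dvd_base hp hq hd hk h
  have : Fact (ringChar F).Prime := ⟨CharP.char_is_prime F (ringChar F)⟩
  obtain ⟨n, hn⟩ := hK.1
  obtain ⟨v, hv⟩ : ∃ v : Fin d → F, v ≠ 0 := ⟨Pi.single ⟨0, by omega⟩ 1, by simp⟩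
  -- The index is a power of `p`, and `p` is not the characteristic. So the group of transvections
  -- with centre `v`, being a group of characteristic-power order, fixes a coset of `K` and lies in
  -- a conjugate of `K`.
  have hr : ¬ ringChar F ∣ Nat.card (X ⧸ K) := by
    change ¬ _ ∣ K.index
    rw [hn]
    intro hdvd
    have h1 := (Nat.prime_dvd_prime_iff_eq Fact.out hp).1
      ((Fact.out : (ringChar F).Prime).dvd_of_dvd_pow hdvd)
    refine hpq ?_
    rw [← h1]
    have := Fintype.ofFinite F
    exact (ringChar.spec F _).1 (by rw [Nat.card_eq_fintype_card, FiniteField.cast_card_eq_zero])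
  obtain ⟨x, hx⟩ := (isPGroup_transvectionGroup hρ v).nonempty_fixed_point_of_prime_not_dvd_card
    (X ⧸ K) hr
  obtain ⟨x, rfl⟩ := QuotientGroup.mk_surjective x
  have hTK : transvectionGroup ρ v ≤ K.map (MulAut.conj x).toMonoidHom := by
    intro t ht
    have h1 : ((t * x : X) : X ⧸ K) = (x : X ⧸ K) := hx ⟨t, ht⟩
    rw [mem_map_conj, mul_assoc]
    exact QuotientGroup.eq.1 h1.symm
  have hconj : ConjIn K (K.map (MulAut.conj x).toMonoidHom) := ⟨x, rfl⟩
  have hK' := hK.of_autConj hconj.autConj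
  generalize K.map (MulAut.conj x).toMonoidHom = K' at *
  obtain ⟨W, hW, hKW⟩ := exists_invariant_subspace hρ hTK
  have hvW : v ∈ W := (hW v).2 ⟨1, K'.one_mem, 1, by simp⟩
  have hbot : Module.finrank F W ≠ 0 := by
    intro h0
    rw [Submodule.finrank_eq_zero] at h0
    exact hv (by simpa [h0] using hvW)
  -- If `W = V`, then `K'` is transitive on the `p ^ k` lines, so `p` divides `|K'|`.
  have htop : Module.finrank F W ≠ d := by
    intro h0
    have hWtop : W = ⊤ := Submodule.eq_top_of_finrank_eq (by rw [h0, Module.finrank_fin_fun])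
    have h1 := index_repStab_span (ρ := ρ.comp K'.subtype) v hv fun x hx => by
      obtain ⟨g, hg, c, hc⟩ := (hW x).1 (hWtop ▸ Submodule.mem_top)
      exact ⟨⟨g, hg⟩, c, fun hc0 => hx (by rw [hc, hc0, zero_smul]), hc⟩
    rw [card_projectivization h] at h1
    have h2 := h1 ▸ Subgroup.index_dvd_card (repStab (ρ.comp K'.subtype) (Submodule.span F {v}))
    exact hp.one_lt.ne' (Nat.eq_one_of_dvd_coprimes hK'.2
      ((dvd_pow_self p (by omega)).trans h2) dvd_rfl)
  have hle : Module.finrank F W ≤ d := by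
    simpa using Submodule.finrank_le W
  -- This index divides that of `K'`, a power of `p` dividing `p ^ k * M`.
  have hindex : (repStab ρ W).index ≤ p ^ k := by
    obtain ⟨n', hn'⟩ := hK'.1
    have h1 : p ^ n' ∣ p ^ k * M := hn' ▸ K'.index_dvd_card.trans hX
    have h2 := (Nat.Coprime.pow_left n' hM.symm).dvd_of_dvd_mul_right h1
    exact Nat.le_of_dvd (pow_pos hp.pos k)
      ((Subgroup.index_dvd_of_le hKW).trans (hn' ▸ h2))
  have hlt : p ^ k < Nat.card F ^ d := by
    have h1 : p ^ k * 1 ≤ p ^ k * (Nat.card F - 1) := Nat.mul_le_mul_left _ (by omega)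
    have h2 : 0 < Nat.card F ^ d := Nat.pow_pos (by omega)
    omega
  -- With `j = dim W`, `q ^ (j * (d - j)) ≤ p ^ k < q ^ d` gives `j * (d - j) < d`, which fails for
  -- `2 ≤ j ≤ d - 2`.
  have hfin : Module.finrank F W = 1 ∨ Module.finrank F W = d - 1 := by
    have h1 := (Nat.pow_lt_pow_iff_right hq).1
      (((pow_le_index_repStab hρ W).trans hindex).trans_lt hlt)
    by_contra! hne
    obtain ⟨a, ha⟩ : ∃ a, Module.finrank F W = a + 2 := ⟨Module.finrank F W - 2, by omega⟩
    obtain ⟨b, hb⟩ : ∃ b, d = a + 2 + (b + 2) := ⟨d - a - 4, by omega⟩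
    rw [ha, show d - (a + 2) = b + 2 by omega] at h1
    nlinarith
  refine ⟨W, hfin, ?_⟩
  rw [← hK'.eq_of_le (isPComplement_repStab hp hd h hρ hM hX hfin) hKW]
  exact hconj.symm

include hp hd hk h hρ hM hX in
-- Conjugation by `g` turns the stabiliser of `U` into that of its image under `g`, and a proper
-- nonzero subspace is determined by its stabiliser. So conjugacy preserves the dimension, `1 ≠ d -
-- 1`, and each stabiliser is its own normaliser.
theorem isComplSystem_repStab {U : Fin 2 → Submodule F (Fin d → F)}
    (hU₀ : Module.finrank F (U 0) = 1) (hU₁ : Module.finrank F (U 1) = d - 1) :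
    IsComplSystem p k fun i => repStab ρ (U i) := by
  have hU : ∀ i, Module.finrank F (U i) = 1 ∨ Module.finrank F (U i) = d - 1 := by
    intro i
    fin_cases i
    exacts [Or.inl hU₀, Or.inr hU₁]
  have bot : ∀ W : Submodule F (Fin d → F),
      (Module.finrank F W = 1 ∨ Module.finrank F W = d - 1) → W ≠ ⊥ := by
    rintro W hW rfl
    rw [finrank_bot] at hW
    omega
  have top : ∀ W : Submodule F (Fin d → F),
      (Module.finrank F W = 1 ∨ Module.finrank F W = d - 1) → W ≠ ⊤ := by
    rintro W hW rfl
    rw [finrank_top, Module.finrank_fin_fun] at hW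
    omega
  refine ⟨fun i => isPComplement_repStab hp hd h hρ hM hX (hU i),
    fun i => index_repStab hd h hρ (hU i), fun L hL => ?_, ?_, ?_⟩
  · obtain ⟨W, hW, hWL⟩ := hL.exists_conjIn_repStab hp hd hk h hρ hM hX
    rcases hW with hW' | hW'
    · exact ⟨0, (conjIn_repStab hρ hd (hU 0) (hU₀.trans hW'.symm)).trans hWL⟩
    · exact ⟨1, (conjIn_repStab hρ hd (hU 1) (hU₁.trans hW'.symm)).trans hWL⟩
  · rintro i j ⟨g, hg⟩
    rw [map_conj_repStab] at hg
    have h1 := eq_of_repStab_le hρ (bot _ (hU j)) (top _ (hU j)) hg.le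
    have h2 : Module.finrank F (U i) = Module.finrank F (U j) := by
      rw [← h1, LinearEquiv.finrank_map_eq (ρ g)]
    fin_cases i <;> fin_cases j
    · rfl
    · exact absurd (hU₀.symm.trans (h2.trans hU₁)) (by omega)
    · exact absurd (hU₀.symm.trans (h2.symm.trans hU₁)) (by omega)
    · rfl
  · intro i g hg
    rw [map_conj_repStab] at hg
    exact eq_of_repStab_le hρ (bot _ (hU i)) (top _ (hU i)) hg.le

end Classification

/-! ### Wreath products with cyclic groups -/

section Wreath

variable {H : Type*} [Group H] {m : ℕ}

/-- The subgroup `∏ i, L i` of the base group `H ^ m` of `H ≀ C_m`. -/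
def basePi (L : Multiplicative (ZMod m) → Subgroup H) : Subgroup (CyclicWreath H m) :=
  (Subgroup.pi Set.univ L).map (baseHom H m)

theorem baseHom_injective : Function.Injective (baseHom H m) := fun _ _ h =>
  congrArg RegularWreathProduct.left h

theorem basePi_injective :
    Function.Injective (basePi : (_ → Subgroup H) → Subgroup (CyclicWreath H m)) :=
  (Subgroup.map_injective baseHom_injective).comp pi_univ_injective

theorem mem_basePi {L : Multiplicative (ZMod m) → Subgroup H} {x : CyclicWreath H m} :
    x ∈ basePi L ↔ x.right = 1 ∧ ∀ i, x.left i ∈ L i := by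
  constructor
  · rintro ⟨y, hy, rfl⟩
    exact ⟨rfl, fun i => hy i trivial⟩
  · rintro ⟨h1, h2⟩
    exact ⟨x.left, fun i _ => h2 i, RegularWreathProduct.ext rfl h1.symm⟩

theorem map_conj_basePi (L : Multiplicative (ZMod m) → Subgroup H) (g : CyclicWreath H m) :
    (basePi L).map (MulAut.conj g).toMonoidHom =
      basePi fun i => (L (g.right⁻¹ * i)).map (MulAut.conj (g.left i)).toMonoidHom := by
  ext x
  simp only [mem_map_conj, mem_basePi, RegularWreathProduct.mul_right,
    RegularWreathProduct.mul_left, RegularWreathProduct.inv_left, RegularWreathProduct.inv_right]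
  have h1 : g.right⁻¹ * x.right * g.right = x.right := by
    rw [mul_comm, mul_inv_cancel_left]
  rw [h1]
  refine and_congr_right fun h2 => ?_
  constructor
  · intro h i
    simpa [h2] using h (g.right⁻¹ * i)
  · intro h i
    simpa [h2] using h (g.right * i)

variable {p k : ℕ} {K : Fin 2 → Subgroup H}

theorem wreathSub_eq (φ : Multiplicative (ZMod m) → Fin 2) :
    wreathSub K φ = basePi fun i => K (φ i) := rfl

theorem conjIn_wreathSub_iff {φ : Multiplicative (ZMod m) → Fin 2}
    {M : Subgroup (CyclicWreath H m)} :
    ConjIn (wreathSub K φ) M ↔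
      ∃ c, ∃ L, (∀ i, ConjIn (K (shift c φ i)) (L i)) ∧ basePi L = M := by
  constructor
  · rintro ⟨g, rfl⟩
    rw [wreathSub_eq, map_conj_basePi]
    exact ⟨g.right⁻¹, _, fun i => ⟨g.left i, rfl⟩, rfl⟩
  · rintro ⟨c, L, hL, rfl⟩
    choose f hf using hL
    refine ⟨⟨f, c⁻¹⟩, ?_⟩
    rw [wreathSub_eq, map_conj_basePi]
    congr 1
    ext1 i
    rw [← hf, inv_inv]
    rfl

theorem conjIn_wreathSub_wreathSub_iff (hK : IsComplSystem p k K)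
    {φ ψ : Multiplicative (ZMod m) → Fin 2} :
    ConjIn (wreathSub K φ) (wreathSub K ψ) ↔ ∃ c, ψ = shift c φ := by
  rw [conjIn_wreathSub_iff]
  refine exists_congr fun c => ⟨?_, ?_⟩
  · rintro ⟨L, hL, h⟩
    obtain rfl := basePi_injective h
    exact funext fun i => (hK.eq_of_conjIn _ _ (hL i)).symm
  · rintro rfl
    exact ⟨_, fun i => ConjIn.refl _, rfl⟩

theorem ncard_conj_wreathSub [NeZero m] (hK : IsComplSystem p k K) (hp : p.Prime)
    (φ : Multiplicative (ZMod m) → Fin 2) :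
    Set.ncard {M | ConjIn (wreathSub K φ) M} =
      Set.ncard {ψ | ∃ c, ψ = shift c φ} * p ^ (k * m) := by
  -- `b i` enumerates the conjugates of `K i`. Conjugates of `wreathSub K φ` then correspond to
  -- pairs of a shift of `φ` and a tuple of `m` labels; the shift is recoverable because `K 0` and
  -- `K 1` are not conjugate.
  have hb : ∀ i, ∃ b : Fin (p ^ k) → Subgroup H, Function.Injective b ∧
      ∀ L, ConjIn (K i) L ↔ ∃ s, b s = L := by
    intro i
    have hcard := hK.ncard_conj i
    have : Finite {L | ConjIn (K i) L} :=
      Set.finite_of_ncard_ne_zero (hcard ▸ pow_ne_zero _ hp.ne_zero)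
    let e := (Finite.equivFinOfCardEq hcard).symm
    refine ⟨fun s => e s, fun s t h => e.injective (Subtype.ext h), fun L => ⟨fun h => ?_, ?_⟩⟩
    · exact ⟨e.symm ⟨L, h⟩, by simp⟩
    · rintro ⟨s, rfl⟩
      exact (e s).2
  choose b hinj hb using hb
  have hb' : ∀ i s, ConjIn (K i) (b i s) := fun i s => (hb i _).2 ⟨s, rfl⟩
  let S : Set (Multiplicative (ZMod m) → Fin 2) := {ψ | ∃ c, ψ = shift c φ}
  let T : Set ((Multiplicative (ZMod m) → Fin 2) × (Multiplicative (ZMod m) → Fin (p ^ k))) :=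
    S ×ˢ Set.univ
  have himage : {M | ConjIn (wreathSub K φ) M} =
      (fun x => basePi fun i => b (x.1 i) (x.2 i)) '' T := by
    ext M
    rw [Set.mem_ofPred_eq, conjIn_wreathSub_iff]
    constructor
    · rintro ⟨c, L, hL, rfl⟩
      choose t ht using fun i => (hb _ _).1 (hL i)
      exact ⟨(shift c φ, t), ⟨⟨c, rfl⟩, trivial⟩, congrArg basePi (funext ht)⟩
    · rintro ⟨⟨ψ, t⟩, ⟨⟨c, rfl⟩, -⟩, rfl⟩
      exact ⟨c, _, fun i => hb' _ _, rfl⟩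
  have hT : Set.InjOn (fun x : (Multiplicative (ZMod m) → Fin 2) ×
      (Multiplicative (ZMod m) → Fin (p ^ k)) => basePi fun i => b (x.1 i) (x.2 i)) T := by
    rintro ⟨ψ, t⟩ - ⟨ψ', t'⟩ - h
    have h' := basePi_injective h
    have h1 : ψ = ψ' := funext fun i => hK.eq_of_conjIn _ _
      (((hb' (ψ i) (t i)).trans ((congrFun h' i) ▸ ConjIn.refl _)).trans
        (hb' (ψ' i) (t' i)).symm)
    subst h1
    rw [Prod.mk.injEq]
    exact ⟨rfl, funext fun i => hinj _ (congrFun h' i)⟩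
  rw [himage, hT.ncard_image, Set.ncard_prod, Set.ncard_univ, Nat.card_fun,
    Nat.card_fin, ← pow_mul]
  congr 2
  rw [Nat.card_congr Multiplicative.toAdd, Nat.card_zmod]

/-- Cyclic shifts as a group action. -/
abbrev shiftAction (m : ℕ) :
    MulAction (Multiplicative (ZMod m)) (Multiplicative (ZMod m) → Fin 2) where
  smul := shift
  one_smul φ := funext fun x => congrArg φ (one_mul x)
  mul_smul a b φ := funext fun x => congrArg φ (by rw [← mul_assoc, mul_comm b])

theorem exists_index_eq_ncard_shift (φ : Multiplicative (ZMod m) → Fin 2) :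
    ∃ T : Subgroup (Multiplicative (ZMod m)), (∀ c, c ∈ T ↔ shift c φ = φ) ∧
      Set.ncard {ψ | ∃ c, ψ = shift c φ} = T.index := by
  let _ := shiftAction m
  refine ⟨MulAction.stabilizer _ φ, fun c => Iff.rfl, ?_⟩
  rw [MulAction.index_stabilizer]
  congr 1
  ext ψ
  exact exists_congr fun c => eq_comm

theorem card_mulZMod (m : ℕ) : Nat.card (Multiplicative (ZMod m)) = m := by
  rw [Nat.card_congr Multiplicative.toAdd, Nat.card_zmod]

theorem exists_ncard_shift_eq (hp : p.Prime) {e : ℕ}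
    (φ : Multiplicative (ZMod (p ^ e)) → Fin 2) :
    ∃ f ≤ e, Set.ncard {ψ | ∃ c, ψ = shift c φ} = p ^ f := by
  obtain ⟨T, -, hT⟩ := exists_index_eq_ncard_shift φ
  have h := T.index_dvd_card
  rw [card_mulZMod] at h
  rw [hT]
  exact (Nat.dvd_prime_pow hp).1 h

theorem exists_shift_orbit (hp : p.Prime) {e f : ℕ} (hf : f ≤ e) :
    ∃ φ : Multiplicative (ZMod (p ^ e)) → Fin 2,
      Set.ncard {ψ | ∃ c, ψ = shift c φ} = p ^ f := by
  classical
  have : Fact p.Prime := ⟨hp⟩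
  have : NeZero (p ^ e) := ⟨pow_ne_zero _ hp.ne_zero⟩
  obtain ⟨T, hT⟩ := Sylow.exists_subgroup_card_pow_prime (G := Multiplicative (ZMod (p ^ e))) p
    (n := e - f) (by rw [card_mulZMod]; exact pow_dvd_pow p (Nat.sub_le e f))
  -- The indicator function of a subgroup `T` of order `p ^ (e - f)` has stabiliser `T`, of index `p
  -- ^ f`.
  let φ : Multiplicative (ZMod (p ^ e)) → Fin 2 := fun x => if x ∈ T then 1 else 0
  have hφ : ∀ x, φ x = 1 ↔ x ∈ T := fun x => by simp [φ]
  refine ⟨φ, ?_⟩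
  obtain ⟨S, hS, hcard⟩ := exists_index_eq_ncard_shift φ
  have hST : S = T := by
    ext c
    rw [hS]
    constructor
    · intro h
      have := congrFun h 1
      rw [(hφ 1).2 T.one_mem, shift, hφ, mul_one] at this
      exact this
    · intro h
      ext1 x
      simp [φ, shift, T.mul_mem_cancel_left h]
  have h1 := T.card_mul_index
  rw [hT, card_mulZMod] at h1
  rw [hcard, hST]
  refine Nat.eq_of_mul_eq_mul_left (pow_pos hp.pos (e - f)) ?_
  rw [h1, ← pow_add, Nat.sub_add_cancel hf]

theorem index_range_baseHom : (baseHom H m).range.index = m := by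
  have h1 : (baseHom H m).range =
      (RegularWreathProduct.rightHom : CyclicWreath H m →* _).ker := by
    ext x
    constructor
    · rintro ⟨y, rfl⟩
      rfl
    · intro hx
      exact ⟨x.left, RegularWreathProduct.ext rfl (MonoidHom.mem_ker.1 hx).symm⟩
  rw [h1, Subgroup.index_ker, MonoidHom.range_eq_top.2, Subgroup.card_top, card_mulZMod]
  exact fun c => ⟨RegularWreathProduct.inl c, RegularWreathProduct.fun_id c⟩

theorem isPComplement_map_baseHom {e : ℕ} {L : Subgroup (Multiplicative (ZMod (p ^ e)) → H)}
    (hL : IsPComplement p L) : IsPComplement p (L.map (baseHom H (p ^ e))) := by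
  obtain ⟨⟨n, hn⟩, h2⟩ := hL
  refine ⟨⟨n + e, ?_⟩, ?_⟩
  · rw [Subgroup.index_map_of_injective _ baseHom_injective, hn, index_range_baseHom, pow_add]
  · rwa [Subgroup.card_map_of_injective baseHom_injective]

/-- The `p`-complements of `H ≀ C_m`, where `m` is a power of `p`, are those of the base group. -/
theorem IsPComplement.exists_eq_map_baseHom [Finite H] (hp : p.Prime) {e : ℕ}
    {L : Subgroup (CyclicWreath H (p ^ e))} (hL : IsPComplement p L) :
    ∃ L', IsPComplement p L' ∧ L = L'.map (baseHom H (p ^ e)) := by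
  have hle : L ≤ (baseHom H (p ^ e)).range := by
    intro x hx
    -- This order divides both `|L|`, which is prime to `p`, and `p ^ e`.
    have h1 : orderOf x.right = 1 := by
      refine Nat.eq_one_of_dvd_coprimes (Nat.Coprime.pow_right e hL.2)
        ((orderOf_map_dvd RegularWreathProduct.rightHom x).trans ?_) ?_
      · exact Subgroup.orderOf_dvd_natCard L hx
      · exact (orderOf_dvd_natCard _).trans (card_mulZMod (p ^ e)).dvd
    exact ⟨x.left, RegularWreathProduct.ext rfl (orderOf_eq_one_iff.1 h1).symm⟩
  have hL' := Subgroup.map_comap_eq_self hle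
  refine ⟨L.comap (baseHom H (p ^ e)), ⟨?_, ?_⟩, hL'.symm⟩
  · obtain ⟨n, hn⟩ := hL.1
    have h1 : (L.comap (baseHom H (p ^ e))).index ∣ L.index := by
      rw [Subgroup.index_comap]
      exact Subgroup.relIndex_dvd_index_of_le hle
    obtain ⟨a, -, ha⟩ := (Nat.dvd_prime_pow hp).1 (hn ▸ h1)
    exact ⟨a, ha⟩
  · rw [← Subgroup.card_map_of_injective baseHom_injective, hL']
    exact hL.2

theorem isPComplement_wreathSub (hp : p.Prime) {e : ℕ} (hK : IsComplSystem p k K)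
    (φ : Multiplicative (ZMod (p ^ e)) → Fin 2) : IsPComplement p (wreathSub K φ) := by
  have : NeZero (p ^ e) := ⟨pow_ne_zero _ hp.ne_zero⟩
  exact isPComplement_map_baseHom (isPComplement_powSub hK φ)

/-- The two subgroups match under an automorphism of the base group. It need not extend to the
wreath product, so only an isomorphism results. -/
theorem isom_of_isPComplement_wreath [Finite H] (hp : p.Prime) {e : ℕ}
    (hK : IsComplSystem p k K) (hKK : AutConj (K 0) (K 1))
    {L M : Subgroup (CyclicWreath H (p ^ e))} (hL : IsPComplement p L) (hM : IsPComplement p M) :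
    Isom L M := by
  have : NeZero (p ^ e) := ⟨pow_ne_zero _ hp.ne_zero⟩
  obtain ⟨L, hL', rfl⟩ := hL.exists_eq_map_baseHom hp
  obtain ⟨M, hM', rfl⟩ := hM.exists_eq_map_baseHom hp
  obtain ⟨f⟩ := (autConj_of_isPComplement hp hK hKK hL' hM').isom
  exact ⟨(L.equivMapOfInjective _ baseHom_injective).symm.trans
    (f.trans (M.equivMapOfInjective _ baseHom_injective))⟩

/-- The invariant that separates automorphism orbits in the wreath product. -/
theorem ncard_conj_eq_of_autConj {G : Type*} [Group G] {L M : Subgroup G} :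
    AutConj L M → Set.ncard {N | ConjIn L N} = Set.ncard {N | ConjIn M N} := by
  rintro ⟨α, rfl⟩
  have h : {N | ConjIn (L.map α.toMonoidHom) N} =
      (fun N : Subgroup G => N.map α.toMonoidHom) '' {N | ConjIn L N} := by
    ext N
    constructor
    · intro hN
      refine ⟨N.map α.symm.toMonoidHom, ?_, ?_⟩
      · have := hN.map α.symm.toMonoidHom
        rw [Subgroup.map_map] at this
        simpa using this
      · simp only [Subgroup.map_map]
        simp
    · rintro ⟨N, hN, rfl⟩
      exact ConjIn.map _ hN
  rw [h, Set.ncard_image_of_injective _ (Subgroup.map_injective α.injective)]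

theorem le_numAutOrbits_wreath [Finite H] (hp : p.Prime) {e : ℕ} (hK : IsComplSystem p k K) :
    e + 1 ≤ numAutOrbits p (CyclicWreath H (p ^ e)) := by
  have : NeZero (p ^ e) := ⟨pow_ne_zero _ hp.ne_zero⟩
  choose φ hφ using fun f : Fin (e + 1) => exists_shift_orbit hp (Nat.le_of_lt_succ f.2)
  rw [← Nat.card_fin (e + 1)]
  refine Nat.card_le_card_of_injective (fun f => Quotient.mk _
    ⟨wreathSub K (φ f), isPComplement_wreathSub hp hK (φ f)⟩) fun f f' h => ?_
  have h1 := ncard_conj_eq_of_autConj (Quotient.exact h)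
  dsimp only at h1
  rw [ncard_conj_wreathSub hK hp, ncard_conj_wreathSub hK hp, hφ, hφ] at h1
  exact Fin.ext (Nat.pow_right_injective hp.two_le
    (Nat.eq_of_mul_eq_mul_right (pow_pos hp.pos _) h1))

end Wreath

/-! ### Socles of products -/

section Socle

variable {G G' : Type*} [Group G] [Group G']

/-- `M` is the unique minimal normal subgroup of `G`. -/
structure IsMonolith (M : Subgroup G) : Prop where
  normal : M.Normal
  ne_bot : M ≠ ⊥
  le : ∀ N : Subgroup G, N.Normal → N ≠ ⊥ → M ≤ N

/-- `N` is a minimal normal subgroup of `G`. -/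
structure IsMinNormal (N : Subgroup G) : Prop where
  normal : N.Normal
  ne_bot : N ≠ ⊥
  le : ∀ M : Subgroup G, M.Normal → M ≤ N → M ≠ ⊥ → N ≤ M

variable (G) in
/-- The socle: the subgroup generated by the minimal normal subgroups. -/
def socle : Subgroup G := sSup {N | IsMinNormal N}

theorem IsMinNormal.map {N : Subgroup G} (hN : IsMinNormal N) (e : G ≃* G') :
    IsMinNormal (N.map e.toMonoidHom) where
  normal := hN.normal.map _ e.surjective
  ne_bot h := hN.ne_bot ((N.map_eq_bot_iff_of_injective e.injective).1 h)
  le M hM hMN hM0 := by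
    rw [Subgroup.map_le_iff_le_comap]
    refine hN.le _ (hM.comap _) ?_ fun h => hM0 ?_
    · rw [← N.comap_map_eq_self_of_injective (f := e.toMonoidHom) e.injective]
      exact Subgroup.comap_mono hMN
    · rw [← Subgroup.map_comap_eq_self_of_surjective (f := e.toMonoidHom) e.surjective M, h,
        Subgroup.map_bot]

theorem map_socle_le (e : G ≃* G') : (socle G).map e.toMonoidHom ≤ socle G' := by
  rw [Subgroup.map_le_iff_le_comap]
  refine sSup_le fun N hN => ?_
  rw [← Subgroup.map_le_iff_le_comap]
  exact le_sSup (IsMinNormal.map hN e)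

theorem card_socle_eq (e : G ≃* G') : Nat.card (socle G) = Nat.card (socle G') := by
  have h : (socle G).map e.toMonoidHom = socle G' :=
    le_antisymm (map_socle_le e)
      fun x hx => ⟨e.symm x, map_socle_le e.symm ⟨x, hx, rfl⟩, e.apply_symm_apply x⟩
  rw [← h, Subgroup.card_map_of_injective (f := e.toMonoidHom) e.injective]

theorem IsMonolith.isMinNormal {M : Subgroup G} (hM : IsMonolith M) : IsMinNormal M :=
  ⟨hM.normal, hM.ne_bot, fun N hN _ h0 => hM.le N hN h0⟩

/-- The socle of a product of groups each of which has a unique minimal normal subgroup. -/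
theorem socle_pi {ι : Type*} [Finite ι] {G : ι → Type*} [∀ i, Group (G i)]
    {M : ∀ i, Subgroup (G i)} (hM : ∀ i, IsMonolith (M i)) :
    socle (∀ i, G i) = Subgroup.pi Set.univ M := by
  classical
  apply le_antisymm
  · refine sSup_le fun N hN x hx i _ => ?_
    -- If the projection of `N` is nontrivial, it contains `M i`. Then the preimage of `M i` meets
    -- `N` nontrivially, and minimality puts `N` inside it.
    by_cases hbot : N.map (Pi.evalMonoidHom G i) = ⊥
    · have h1 : x i ∈ N.map (Pi.evalMonoidHom G i) := ⟨x, hx, rfl⟩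
      rw [hbot, Subgroup.mem_bot] at h1
      exact h1 ▸ (M i).one_mem
    · have hle := (hM i).le _ (hN.normal.map _ (Function.surjective_eval i)) hbot
      obtain ⟨m, hm, hm1⟩ := (M i).bot_or_exists_ne_one.resolve_left (hM i).ne_bot
      obtain ⟨y, hy, rfl⟩ := hle hm
      have := hN.normal
      have := (hM i).normal
      have h1 := hN.le (N ⊓ (M i).comap (Pi.evalMonoidHom G i)) inferInstance inf_le_left
        (fun h => hm1 (by
          rw [show y = 1 from (Subgroup.eq_bot_iff_forall _).1 h y ⟨hy, hm⟩, map_one]))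
      exact (h1 hx).2
  -- Each `M i`, embedded in its coordinate, is itself a minimal normal subgroup.
  · rw [Subgroup.pi_le_iff]
    intro i
    refine le_sSup ⟨⟨?_⟩, ?_, ?_⟩
    · rintro _ ⟨m, hm, rfl⟩ g
      refine ⟨g i * m * (g i)⁻¹, (hM i).normal.conj_mem m hm _, ?_⟩
      ext j
      by_cases hj : j = i
      · subst hj
        simp
      · simp [hj]
    · intro h
      exact (hM i).ne_bot (((M i).map_eq_bot_iff_of_injective (Pi.mulSingle_injective i)).1 h)
    · intro N hN hle h0
      rw [Subgroup.map_le_iff_le_comap]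
      refine (hM i).le _ (hN.comap _) fun h => h0 ?_
      rw [Subgroup.eq_bot_iff_forall]
      intro x hx
      obtain ⟨m, hm, rfl⟩ := hle hx
      rw [(Subgroup.eq_bot_iff_forall _).1 h m hx, map_one]

theorem socle_eq_of_isMonolith {M : Subgroup G} (hM : IsMonolith M) : socle G = M :=
  le_antisymm (sSup_le fun _ hN => hN.le M hM.normal (hM.le _ hN.normal hN.ne_bot) hM.ne_bot)
    (le_sSup hM.isMinNormal)

end Socle

/-! ### Isomorphism classes distinguished by the socle -/

section IsoClasses

variable {p k : ℕ} {H : Type*} [Group H] [Finite H] {K : Fin 2 → Subgroup H}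
  {M : ∀ j, Subgroup (K j)}

omit [Finite H] in
theorem not_isom_of_isMonolith (hM : ∀ j, IsMonolith (M j))
    (hcard : Nat.card (M 0) < Nat.card (M 1)) : ¬ Isom (K 0) (K 1) := by
  rintro ⟨e⟩
  have h := card_socle_eq e
  rw [socle_eq_of_isMonolith (hM 0), socle_eq_of_isMonolith (hM 1)] at h
  exact hcard.ne h

omit [Finite H] in
theorem card_socle_powSub (hM : ∀ j, IsMonolith (M j)) {m : ℕ} (φ : Fin m → Fin 2) :
    Nat.card (socle (powSub K φ)) = Nat.card (M 1) ^ Set.ncard {j | φ j = 1} *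
      Nat.card (M 0) ^ (m - Set.ncard {j | φ j = 1}) := by
  rw [powSub, card_socle_eq (piMulEquiv fun i => K (φ i)), socle_pi fun i => hM (φ i)]
  have h1 : Nat.card (Subgroup.pi Set.univ fun i => M (φ i)) = ∏ i, Nat.card (M (φ i)) := by
    rw [← Nat.card_pi]
    exact Nat.card_congr
      { toFun x i := ⟨x.1 i, x.2 i trivial⟩
        invFun x := ⟨fun i => x i, fun i _ => (x i).2⟩
        left_inv _ := rfl
        right_inv _ := rfl }
  have h2 : ∀ i, Nat.card (M (φ i)) = if φ i = 1 then Nat.card (M 1) else Nat.card (M 0) := by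
    intro i
    generalize φ i = j
    fin_cases j <;> simp
  have h3 : Set.ncard {j | φ j = 1} = (Finset.univ.filter fun j => φ j = 1).card := by
    rw [← Set.ncard_coe_finset]
    simp
  rw [h1, Finset.prod_congr rfl fun i _ => h2 i, Finset.prod_ite, Finset.prod_const,
    Finset.prod_const, h3]
  congr 2
  rw [Finset.filter_not, Finset.card_sdiff_of_subset (Finset.filter_subset _ _), Finset.card_univ,
    Fintype.card_fin]

theorem isom_powSub_iff (hM : ∀ j, IsMonolith (M j))
    (hcard : Nat.card (M 0) < Nat.card (M 1)) {m : ℕ} (φ ψ : Fin m → Fin 2) :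
    Isom (powSub K φ) (powSub K ψ) ↔ Set.ncard {j | φ j = 1} = Set.ncard {j | ψ j = 1} := by
  constructor
  · rintro ⟨e⟩
    have h := card_socle_eq e
    rw [card_socle_powSub hM, card_socle_powSub hM] at h
    have hle : ∀ φ : Fin m → Fin 2, Set.ncard {j | φ j = 1} ≤ m := fun φ => by
      simpa using Set.ncard_le_card {j | φ j = 1}
    -- The order of the socle increases strictly with the number of ones.
    have key : ∀ b b', b < b' → b' ≤ m →
        Nat.card (M 1) ^ b * Nat.card (M 0) ^ (m - b) <
          Nat.card (M 1) ^ b' * Nat.card (M 0) ^ (m - b') := by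
      intro b b' hb hb'
      have h0 : 0 < Nat.card (M 0) := Nat.card_pos
      obtain ⟨c, rfl⟩ := Nat.exists_eq_add_of_lt hb
      obtain ⟨a, rfl⟩ := Nat.exists_eq_add_of_le hb'
      rw [show b + c + 1 + a - b = c + 1 + a by omega, Nat.add_sub_cancel_left,
        show b + c + 1 = b + (c + 1) by ring,
        pow_add _ b (c + 1), pow_add _ (c + 1) a, mul_assoc]
      exact Nat.mul_lt_mul_of_pos_left (Nat.mul_lt_mul_of_pos_right
        (Nat.pow_lt_pow_left hcard (by omega)) (pow_pos h0 a)) (pow_pos (h0.trans hcard) b)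
    rcases lt_trichotomy (Set.ncard {j | φ j = 1}) (Set.ncard {j | ψ j = 1}) with h' | h' | h'
    · exact absurd h (key _ _ h' (hle ψ)).ne
    · exact h'
    · exact absurd h (key _ _ h' (hle φ)).ne'
  · intro h
    -- Equal numbers of ones give a permutation of the coordinates carrying one product to the
    -- other.
    obtain ⟨e⟩ : Nonempty ({j // ψ j = 1} ≃ {j // φ j = 1}) := Finite.card_eq.1 h.symm
    have hσ : ∀ j, φ (e.extendSubtype j) = ψ j := by
      intro j
      by_cases hj : ψ j = 1
      · rw [hj]
        exact e.extendSubtype_mem j hj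
      · have := e.extendSubtype_not_mem j hj
        omega
    refine AutConj.isom ⟨(MulEquiv.arrowCongr e.extendSubtype (MulEquiv.refl H)).symm, ?_⟩
    ext x
    simp only [Subgroup.mem_map, powSub, Subgroup.mem_pi]
    constructor
    · rintro ⟨y, hy, rfl⟩ i _
      rw [← hσ]
      exact hy _ trivial
    · intro hx
      refine ⟨MulEquiv.arrowCongr e.extendSubtype (MulEquiv.refl H) x, fun i _ => ?_, by simp⟩
      obtain ⟨i, rfl⟩ := e.extendSubtype.surjective i
      rw [hσ]
      simpa using hx i trivial

theorem numIsoClasses_pow (hp : p.Prime) (hK : IsComplSystem p k K)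
    (hM : ∀ j, IsMonolith (M j)) (hcard : Nat.card (M 0) < Nat.card (M 1)) (m : ℕ) :
    numIsoClasses p (Fin m → H) = m + 1 := by
  let φ : Fin (m + 1) → Fin m → Fin 2 := fun a j => if (j : ℕ) < a then 1 else 0
  have hφ : ∀ a, Set.ncard {j | φ a j = 1} = a := by
    intro a
    have h1 : {j | φ a j = 1} = (Finset.univ.filter fun j : Fin m => (j : ℕ) < a : Finset _) := by
      ext j
      simp [φ]
    rw [h1, Set.ncard_coe_finset, Fin.card_filter_val_lt]
    omega
  rw [numIsoClasses, card_quotient_eq _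
    (fun a => ⟨powSub K (φ a), isPComplement_powSub hK (φ a)⟩), Nat.card_fin]
  · intro a b h
    have := (isom_powSub_iff hM hcard _ _).1 h
    rw [hφ, hφ] at this
    exact Fin.ext this
  · rintro ⟨L, hL⟩
    obtain ⟨ψ, hψ⟩ := exists_conjIn_powSub hp hK hL
    have hle : Set.ncard {j | ψ j = 1} ≤ m := by simpa using Set.ncard_le_card {j | ψ j = 1}
    refine ⟨⟨Set.ncard {j | ψ j = 1}, by omega⟩, ?_⟩
    exact (isom_equivalence _).trans ((isom_powSub_iff hM hcard _ _).2 (hφ _)) hψ.autConj.isom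

end IsoClasses

/-! ### The groups `SL`, `GL` and `PSL` -/

open scoped Matrix

section Instances

variable {F : Type*} [Field F] {d : ℕ}

theorem dotProduct_transpose_mulVec {M A : Matrix (Fin d) (Fin d) F} (h : M * A = 1)
    (a b : Fin d → F) : Mᵀ *ᵥ a ⬝ᵥ A *ᵥ b = a ⬝ᵥ b := by
  rw [Matrix.mulVec_transpose, Matrix.dotProduct_mulVec, Matrix.vecMul_vecMul, h, Matrix.vecMul_one]

theorem sl_transpose_inv (A : Matrix.SpecialLinearGroup (Fin d) F) :
    A⁻¹.transpose = A.transpose⁻¹ := by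
  apply Subtype.ext
  simp [← Matrix.adjugate_transpose]

/-- The inverse transpose automorphism of `SL_d(F)`. -/
def slDual : Matrix.SpecialLinearGroup (Fin d) F ≃* Matrix.SpecialLinearGroup (Fin d) F where
  toFun A := A⁻¹.transpose
  invFun A := A⁻¹.transpose
  left_inv A := by
    dsimp only
    rw [sl_transpose_inv A, inv_inv]
    rfl
  right_inv A := by
    dsimp only
    rw [sl_transpose_inv A, inv_inv]
    rfl
  map_mul' A B := by
    apply Subtype.ext
    rw [mul_inv_rev]
    exact Matrix.transpose_mul _ _

/-- The inverse transpose automorphism of `GL_d(F)`. -/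
def glDual : Matrix.GeneralLinearGroup (Fin d) F ≃* Matrix.GeneralLinearGroup (Fin d) F where
  toFun A := ⟨(A⁻¹.1)ᵀ, A.1ᵀ, by rw [← Matrix.transpose_mul]; simp,
    by rw [← Matrix.transpose_mul]; simp⟩
  invFun A := ⟨(A⁻¹.1)ᵀ, A.1ᵀ, by rw [← Matrix.transpose_mul]; simp,
    by rw [← Matrix.transpose_mul]; simp⟩
  left_inv A := rfl
  right_inv A := rfl
  map_mul' A B := by
    apply Units.ext
    change ((A * B)⁻¹.1)ᵀ = (A⁻¹.1)ᵀ * (B⁻¹.1)ᵀ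
    rw [← Matrix.transpose_mul, mul_inv_rev, Units.val_mul]

theorem isBigRep_sl [Finite F] :
    IsBigRep (Matrix.SpecialLinearGroup.toLin' : Matrix.SpecialLinearGroup (Fin d) F →* _) where
  injective := Matrix.SpecialLinearGroup.toLin'_injective
  exists_eq g hg := by
    have : Fact (ringChar F).Prime := ⟨CharP.char_is_prime F (ringChar F)⟩
    -- In characteristic `r`, `det ^ r = 1` means `(det - 1) ^ r = 0`.
    have h1 : LinearMap.det g.toLinearMap = 1 := by
      have h2 : (LinearEquiv.det g) ^ ringChar F = 1 := by rw [← map_pow, hg, map_one]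
      have h3 : (LinearMap.det g.toLinearMap) ^ ringChar F = 1 := by
        simpa using congrArg Units.val h2
      have h4 : (LinearMap.det g.toLinearMap - 1) ^ ringChar F = 0 := by
        rw [sub_pow_char, h3, one_pow, sub_self]
      exact sub_eq_zero.1 (pow_eq_zero_iff (Fact.out : (ringChar F).Prime).ne_zero |>.1 h4)
    refine ⟨⟨LinearMap.toMatrix' g.toLinearMap, by rw [LinearMap.det_toMatrix', h1]⟩, ?_⟩
    ext1 x
    exact LinearMap.congr_fun (Matrix.toLin'_toMatrix' g.toLinearMap) x
  exists_dual := ⟨slDual, fun A a b => dotProduct_transpose_mulVec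
    (congrArg Subtype.val (inv_mul_cancel A)) a b⟩

variable (F d) in
/-- The isomorphism between matrices and linear automorphisms. -/
abbrev glRep : Matrix.GeneralLinearGroup (Fin d) F →* ((Fin d → F) ≃ₗ[F] (Fin d → F)) :=
  (LinearMap.GeneralLinearGroup.generalLinearEquiv F (Fin d → F)).toMonoidHom.comp
    (Matrix.GeneralLinearGroup.toLin (n := Fin d) (R := F)).toMonoidHom

theorem glRep_bijective : Function.Bijective (glRep F d) :=
  (LinearMap.GeneralLinearGroup.generalLinearEquiv F (Fin d → F)).bijective.comp
    (Matrix.GeneralLinearGroup.toLin (n := Fin d) (R := F)).bijective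

theorem isBigRep_gl : IsBigRep (glRep F d) where
  injective := glRep_bijective.1
  exists_eq g _ := glRep_bijective.2 g
  exists_dual := ⟨glDual, fun A a b => dotProduct_transpose_mulVec
    (by rw [← Units.val_mul, inv_mul_cancel, Units.val_one]) a b⟩

variable [Finite F] {p k : ℕ} (hp : p.Prime) (hd : 3 ≤ d) (hk : 1 ≤ k)
  (h : p ^ k * (Nat.card F - 1) = Nat.card F ^ d - 1)

include hp hd hk h in
theorem exists_card_gl :
    ∃ M : ℕ, M.Coprime p ∧ Nat.card (Matrix.GeneralLinearGroup (Fin d) F) = p ^ k * M := by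
  have := Fintype.ofFinite F
  obtain ⟨M, hM, h1⟩ := exists_prod_eq_mul hp Finite.one_lt_card hd hk h
  refine ⟨M, hM, ?_⟩
  rw [← h1, Matrix.card_GL_field, Nat.card_eq_fintype_card]

variable {U : Fin 2 → Submodule F (Fin d → F)} (hU₀ : Module.finrank F (U 0) = 1)
  (hU₁ : Module.finrank F (U 1) = d - 1)

include hp hd hk h hU₀ hU₁

theorem isComplSystem_gl : IsComplSystem p k fun i => glStab (U i) := by
  obtain ⟨M, hM, h1⟩ := exists_card_gl hp hd hk h
  exact isComplSystem_repStab hp hd hk h isBigRep_gl hM h1.dvd hU₀ hU₁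

theorem isComplSystem_sl :
    IsComplSystem p k fun i => repStab Matrix.SpecialLinearGroup.toLin' (U i) := by
  obtain ⟨M, hM, h1⟩ := exists_card_gl hp hd hk h
  refine isComplSystem_repStab hp hd hk h isBigRep_sl hM ?_ hU₀ hU₁
  rw [← h1]
  exact Subgroup.card_dvd_of_injective Matrix.SpecialLinearGroup.toGL
    (Matrix.SpecialLinearGroup.toGL_injective)

omit hp hd hk h hU₀ hU₁ in
theorem center_le_repStab (W : Submodule F (Fin d → F)) :
    Subgroup.center (Matrix.SpecialLinearGroup (Fin d) F) ≤
      repStab Matrix.SpecialLinearGroup.toLin' W := by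
  intro A hA
  obtain ⟨r, -, hr⟩ := Matrix.SpecialLinearGroup.mem_center_iff.1 hA
  refine mem_linStab_of_le fun x hx => ?_
  rw [Matrix.SpecialLinearGroup.toLin'_apply, ← hr]
  convert W.smul_mem r hx using 1
  ext i
  simp [Matrix.mulVec_diagonal]

omit hp hd hk h hU₀ hU₁ in
theorem comap_pslStab (W : Submodule F (Fin d → F)) :
    (pslStab W).comap (QuotientGroup.mk' _) = repStab Matrix.SpecialLinearGroup.toLin' W := by
  refine Subgroup.comap_map_eq_self ?_
  rw [QuotientGroup.ker_mk']
  exact center_le_repStab W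

/-- The centre of `SL` lies in a `p`-complement, hence has order prime to `p`, so the system
descends. -/
theorem isComplSystem_psl : IsComplSystem p k fun i => pslStab (U i) := by
  have h1 := isComplSystem_sl hp hd hk h hU₀ hU₁
  refine IsComplSystem.of_comap (f := QuotientGroup.mk' _) (QuotientGroup.mk'_surjective _) ?_ ?_
  · rw [QuotientGroup.ker_mk']
    exact Nat.Coprime.of_dvd_left (Subgroup.card_dvd_of_le (center_le_repStab (U 0)))
      (h1.isPComplement 0).2
  · simpa only [comap_pslStab] using h1

omit hp hk h

theorem autConj_glStab : AutConj (glStab (U 0)) (glStab (U 1)) :=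
  autConj_repStab isBigRep_gl hd hU₀ hU₁

/-- The centre is characteristic, so the automorphism of `SL` induces one of `PSL`. -/
theorem autConj_pslStab : AutConj (pslStab (U 0)) (pslStab (U 1)) := by
  obtain ⟨τ, hτ⟩ := autConj_repStab isBigRep_sl hd hU₀ hU₁
  refine ⟨QuotientGroup.congr _ _ τ ?_, ?_⟩
  · exact Subgroup.characteristic_iff_map_eq.1 inferInstance τ
  · rw [pslStab, pslStab, Subgroup.map_map]
    change _ = (repStab Matrix.SpecialLinearGroup.toLin' (U 1)).map _
    rw [← hτ, Subgroup.map_map]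
    rfl

end Instances

/-! ### The affine group and its stabilisers -/

section Affine

variable {F : Type*} [Field F] {d : ℕ}

instance finite_agl [Finite F] : Finite (AGL F d) :=
  Finite.of_injective (fun g : AGL F d => (g : (Fin d → F) → (Fin d → F))) DFunLike.coe_injective

theorem linearHom_surjective :
    Function.Surjective (AffineEquiv.linearHom : AGL F d →* ((Fin d → F) ≃ₗ[F] (Fin d → F))) :=
  fun g => ⟨g.toAffineEquiv, rfl⟩

theorem agl_apply (g : AGL F d) (x y : Fin d → F) : g (x + y) = g.linear x + g y :=
  g.map_vadd y x

theorem eq_constVAdd {g : AGL F d} (h : g.linear = 1) :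
    g = AffineEquiv.constVAdd F (Fin d → F) (g 0) := by
  ext1 x
  have := agl_apply g x 0
  rw [add_zero, h] at this
  rw [this, AffineEquiv.constVAdd_apply, vadd_eq_add, add_comm]
  rfl

theorem card_ker_linearHom [Finite F] :
    Nat.card (AffineEquiv.linearHom : AGL F d →* ((Fin d → F) ≃ₗ[F] (Fin d → F))).ker =
      Nat.card F ^ d := by
  rw [← Nat.card_fin d, ← Nat.card_fun, Nat.card_fin]
  refine Nat.card_congr
    { toFun g := g.1 0
      invFun v := ⟨AffineEquiv.constVAdd F _ v, rfl⟩
      left_inv g := Subtype.ext (eq_constVAdd g.2).symm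
      right_inv v := add_zero v }

theorem conj_constVAdd (g : AGL F d) (v : Fin d → F) :
    g * AffineEquiv.constVAdd F (Fin d → F) v * g⁻¹ =
      AffineEquiv.constVAdd F (Fin d → F) (g.linear v) := by
  rw [mul_inv_eq_iff_eq_mul]
  ext1 x
  exact agl_apply g v x

theorem mem_aglStab {U : Submodule F (Fin d → F)} {g : AGL F d} :
    g ∈ aglStab U ↔ g.linear ∈ linStab U := Iff.rfl

theorem constVAdd_mem_aglStab (U : Submodule F (Fin d → F)) (v : Fin d → F) :
    AffineEquiv.constVAdd F (Fin d → F) v ∈ aglStab U :=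
  mem_aglStab.2 (linStab U).one_mem

/-- The translations by the vectors of `U`, as a subgroup of `V ⋊ Stab(U)`. -/
def translations (U : Submodule F (Fin d → F)) : Subgroup (aglStab U) where
  carrier := {g | ∃ u ∈ U, g.1 = AffineEquiv.constVAdd F (Fin d → F) u}
  one_mem' := ⟨0, U.zero_mem, by ext1 x; simp⟩
  mul_mem' := by
    rintro a b ⟨u, hu, ha⟩ ⟨v, hv, hb⟩
    refine ⟨u + v, U.add_mem hu hv, ?_⟩
    rw [Subgroup.coe_mul, ha, hb, AffineEquiv.constVAdd_add]
    rfl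
  inv_mem' := by
    rintro a ⟨u, hu, ha⟩
    refine ⟨-u, U.neg_mem hu, ?_⟩
    rw [Subgroup.coe_inv, ha]
    exact AffineEquiv.constVAdd_symm F _ u

theorem card_translations (U : Submodule F (Fin d → F)) :
    Nat.card (translations U) = Nat.card U := by
  have h0 : ∀ u : Fin d → F, AffineEquiv.constVAdd F (Fin d → F) u 0 = u := add_zero
  refine Nat.card_congr
    { toFun g := ⟨g.1.1 0, ?_⟩
      invFun u := ⟨⟨_, constVAdd_mem_aglStab U u⟩, u, u.2, rfl⟩
      left_inv := ?_
      right_inv u := Subtype.ext (h0 u) }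
  · obtain ⟨u, hu, hg⟩ := g.2
    rwa [hg, h0]
  · rintro ⟨g, u, hu, hg⟩
    refine Subtype.ext (Subtype.ext ?_)
    change AffineEquiv.constVAdd F _ (g.1 0) = g.1
    rw [hg, h0]

/-- A nontrivial normal subgroup contains a nonzero translation. Conjugating it by elements of the
stabiliser and taking differences produces every translation by a vector of `U`. -/
theorem isMonolith_translations [Finite F] {U : Submodule F (Fin d → F)} (hU : U ≠ ⊥) :
    IsMonolith (translations U) where
  normal := ⟨by
    rintro ⟨n, hn⟩ ⟨u, hu, rfl⟩ g
    exact ⟨g.1.linear u, (mem_linStab_iff.1 g.2 u).1 hu, conj_constVAdd g.1 u⟩⟩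
  ne_bot h := by
    obtain ⟨u, hu, hu0⟩ := U.exists_mem_ne_zero_of_ne_bot hU
    have h1 := (Subgroup.eq_bot_iff_forall _).1 h ⟨_, constVAdd_mem_aglStab U u⟩ ⟨u, hu, rfl⟩
    have h2 := DFunLike.congr_fun (congrArg Subtype.val h1) 0
    exact hu0 (by simpa using h2)
  le N hN hN0 := by
    let t : (Fin d → F) → aglStab U := fun v => ⟨_, constVAdd_mem_aglStab U v⟩
    have ht0 : ∀ v, t v = 1 → v = 0 := by
      intro v hv
      simpa [t] using DFunLike.congr_fun (congrArg Subtype.val hv) 0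
    have htadd : ∀ u v, t (u + v) = t u * t v := fun u v =>
      Subtype.ext (AffineEquiv.constVAdd_add F _ u v)
    have hconj : ∀ (g : aglStab U) v, g * t v * g⁻¹ = t (g.1.linear v) := fun g v =>
      Subtype.ext (conj_constVAdd g.1 v)
    have hlin : ∀ h ∈ linStab U, ∀ x, t x ∈ N → t (h x) ∈ N := by
      intro h hh x hx
      have := hN.conj_mem _ hx ⟨h.toAffineEquiv, hh⟩
      rwa [hconj] at this
    have hdiff : ∀ x u, t x ∈ N → t (x + u) ∈ N → t u ∈ N := by
      intro x u hx hxu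
      rwa [htadd, N.mul_mem_cancel_left hx] at hxu
    -- If `g ∈ N` is not a translation, its commutator with the translation by a vector `v` moved by
    -- its linear part is the translation by `g.linear v - v`.
    obtain ⟨x, hx, hx0⟩ : ∃ x, t x ∈ N ∧ x ≠ 0 := by
      obtain ⟨g, hg, hg1⟩ := N.bot_or_exists_ne_one.resolve_left hN0
      by_cases hl : g.1.linear = 1
      · have h1 : g = t (g.1 0) := Subtype.ext (eq_constVAdd hl)
        refine ⟨g.1 0, h1 ▸ hg, fun h0 => hg1 ?_⟩
        rw [h1, h0]
        exact Subtype.ext (AffineEquiv.constVAdd_zero F _)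
      · obtain ⟨v, hv⟩ : ∃ v, g.1.linear v ≠ v := by
          by_contra! hall
          exact hl (LinearEquiv.ext hall)
        refine ⟨g.1.linear v - v, ?_, sub_ne_zero.2 hv⟩
        have h1 : t (g.1.linear v - v) = g * (t v * g⁻¹ * (t v)⁻¹) := by
          rw [eq_comm, ← mul_assoc, ← mul_assoc, hconj, mul_inv_eq_iff_eq_mul, ← htadd,
            sub_add_cancel]
        rw [h1]
        exact N.mul_mem hg (hN.conj_mem _ (N.inv_mem hg) _)
    suffices hUN : ∀ u ∈ U, t u ∈ N by
      rintro ⟨g, hg⟩ ⟨u, hu, rfl⟩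
      exact hUN u hu
    intro u hu
    by_cases hxU : x ∈ U
    · by_cases hxu : u ∈ Submodule.span F {x}
      · obtain ⟨c, rfl⟩ := Submodule.mem_span_singleton.1 hxu
        by_cases hc : c = 0
        · rw [hc, zero_smul]
          convert N.one_mem
          exact Subtype.ext (AffineEquiv.constVAdd_zero F _)
        · exact hlin (LinearEquiv.smulOfNeZero F _ c hc)
            (mem_linStab_of_le fun y hy => U.smul_mem c hy) x hx
      -- For independent `x`, `u` in `U`, a transvection with centre `u` preserves `U` and sends `x`
      -- to `x + u`.
      · obtain ⟨f, hf1, hf⟩ := exists_dual_eq_one hxu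
        have hfx : f x = 0 := hf x (Submodule.mem_span_singleton_self x)
        obtain ⟨f', hf1', hf'⟩ := exists_dual_eq_one (W := Submodule.span F {u}) (x := x) (by
          intro hs
          obtain ⟨c, hc⟩ := Submodule.mem_span_singleton.1 hs
          have : c = 0 := by simpa [hf1, hfx] using congrArg f hc
          exact hx0 (by rw [← hc, this, zero_smul]))
        have hfu : f' u = 0 := hf' u (Submodule.mem_span_singleton_self u)
        obtain ⟨g, -, hg⟩ := exists_transvection f' u hfu
        refine hdiff x u hx ?_
        have := hlin g (mem_linStab_of_le fun y hy => by
          rw [hg]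
          exact U.add_mem hy (U.smul_mem _ hu)) x hx
        rwa [hg, hf1', one_smul] at this
    -- For `x` outside `U`, a transvection fixing `U` pointwise sends `x` to `x + u`.
    · obtain ⟨f, hf1, hf⟩ := exists_dual_eq_one hxU
      obtain ⟨g, -, hg⟩ := exists_transvection f u (hf u hu)
      refine hdiff x u hx ?_
      have := hlin g (mem_linStab_of_le fun y hy => by rwa [hg, hf y hy, zero_smul, add_zero]) x hx
      rwa [hg, hf1, one_smul] at this

variable [Finite F] {p k : ℕ} (hp : p.Prime) (hd : 3 ≤ d) (hk : 1 ≤ k)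
  (h : p ^ k * (Nat.card F - 1) = Nat.card F ^ d - 1)
  {U : Fin 2 → Submodule F (Fin d → F)} (hU₀ : Module.finrank F (U 0) = 1)
  (hU₁ : Module.finrank F (U 1) = d - 1)

include hp hd hk h hU₀ hU₁ in
-- Pulled back from `GL`: the kernel, the translation group, has order `q ^ d`, prime to `p`.
theorem isComplSystem_agl : IsComplSystem p k fun i => aglStab (U i) := by
  let e := MulEquiv.ofBijective (glRep F d) glRep_bijective
  have h1 : Function.Surjective (e.symm.toMonoidHom.comp
      (AffineEquiv.linearHom : AGL F d →* _)) :=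
    e.symm.surjective.comp linearHom_surjective
  have h2 := (isComplSystem_gl hp hd hk h hU₀ hU₁).comap hp h1 (by
    rw [MonoidHom.ker_comp_of_injective, card_ker_linearHom]
    · exact Nat.Coprime.pow_left _ ((hp.coprime_iff_not_dvd).2
        (not_dvd_base hp Finite.one_lt_card hd hk h)).symm
    · exact e.symm.injective)
  convert h2 using 2 with i
  ext g
  rw [Subgroup.mem_comap, glStab, Subgroup.mem_comap, mem_aglStab]
  exact iff_of_eq (congrArg (· ∈ linStab (U i)) (e.apply_symm_apply g.linear).symm)

include hd hU₀ hU₁ in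
theorem isMonolith_and_card_lt : (∀ i, IsMonolith (translations (U i))) ∧
    Nat.card (translations (U 0)) < Nat.card (translations (U 1)) := by
  constructor
  · intro i
    refine isMonolith_translations fun hbot => ?_
    have := congrArg (fun W : Submodule F (Fin d → F) => Module.finrank F W) hbot
    fin_cases i <;> simp_all; omega
  · rw [card_translations, card_translations, Module.natCard_eq_pow_finrank (K := F) (V := U 0),
      Module.natCard_eq_pow_finrank (K := F) (V := U 1), hU₀, hU₁]
    exact Nat.pow_lt_pow_right Finite.one_lt_card (by omega)

end Affine

/-! ### Existence of the data and assembly of the theorem -/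

theorem mul_sub_one_eq_of_div {p k q d : ℕ} (hq : 2 ≤ q)
    (h : (p : ℚ) ^ k = ((q : ℚ) ^ d - 1) / ((q : ℚ) - 1)) : p ^ k * (q - 1) = q ^ d - 1 := by
  have h1 : ((q : ℚ) - 1) ≠ 0 := by
    have : (2 : ℚ) ≤ q := by exact_mod_cast hq
    linarith
  rw [eq_div_iff h1] at h
  have h2 : 1 ≤ q ^ d := Nat.one_le_pow _ _ (by omega)
  have h3 : ((p ^ k * (q - 1) : ℕ) : ℚ) = ((q ^ d - 1 : ℕ) : ℚ) := by
    rw [Nat.cast_mul, Nat.cast_sub (by omega : 1 ≤ q), Nat.cast_sub h2]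
    push_cast
    exact h
  exact_mod_cast h3

theorem exists_submodule_finrank_eq {F : Type*} [Field F] {d j : ℕ} (h : j ≤ d) :
    ∃ U : Submodule F (Fin d → F), Module.finrank F U = j := by
  refine ⟨LinearMap.range (Fintype.linearCombination F
    (fun i : Fin j => Pi.basisFun F (Fin d) (Fin.castLE h i))), ?_⟩
  rw [Fintype.range_linearCombination, finrank_span_eq_card, Fintype.card_fin]
  exact (Pi.basisFun F (Fin d)).linearIndependent.comp _ (Fin.castLE_injective h)

/-- For `p ∈ NC`, the field and subspaces used in the construction exist. -/
theorem exists_of_mem_NC {p : ℕ} (hp : p ∈ NC) :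
    ∃ (F : Type) (_ : Field F) (_ : Finite F) (d k : ℕ) (U : Fin 2 → Submodule F (Fin d → F)),
      3 ≤ d ∧ 1 ≤ k ∧ p ^ k * (Nat.card F - 1) = Nat.card F ^ d - 1 ∧
      Module.finrank F (U 0) = 1 ∧ Module.finrank F (U 1) = d - 1 := by
  obtain ⟨hp, q, d, k, hq, hd, hk, h⟩ := hp
  have hq2 := hq.two_le
  obtain ⟨r, n, hr, hn, rfl⟩ := (isPrimePow_nat_iff q).1 hq
  have : Fact r.Prime := ⟨hr⟩
  have hcard : Nat.card (GaloisField r n) = r ^ n := GaloisField.card r n hn.ne'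
  have : Finite (GaloisField r n) :=
    Nat.finite_of_card_ne_zero (by rw [hcard]; exact pow_ne_zero _ hr.ne_zero)
  obtain ⟨U₀, h₀⟩ := exists_submodule_finrank_eq (F := GaloisField r n) (show 1 ≤ d by omega)
  obtain ⟨U₁, h₁⟩ := exists_submodule_finrank_eq (F := GaloisField r n) (Nat.sub_le d 1)
  exact ⟨GaloisField r n, inferInstance, this, d, k, ![U₀, U₁], hd, hk,
    by rw [hcard]; exact mul_sub_one_eq_of_div hq2 h, h₀, h₁⟩

end PComplements

theorem mainTheorem6 (p : ℕ) (hp : p ∈ NC) :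
    -- the three families of groups, for every way of writing `p ^ k = (q ^ d - 1) / (q - 1)`
    (∀ (F : Type*) [Field F] [Finite F] (d k : ℕ), 3 ≤ d → 1 ≤ k →
      (p : ℚ) ^ k = ((Nat.card F : ℚ) ^ d - 1) / ((Nat.card F : ℚ) - 1) →
      ∀ U : Fin 2 → Submodule F (Fin d → F),
        Module.finrank F (U 0) = 1 → Module.finrank F (U 1) = d - 1 →
      -- the cartesian powers of `PSL_d(q)`
      (∀ m : ℕ,
        (∀ φ : Fin m → Fin 2, IsPComplement p
          (powSub (fun i => pslStab (U i)) φ)) ∧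
        (∀ φ ψ : Fin m → Fin 2, ConjIn
          (powSub (fun i => pslStab (U i)) φ)
          (powSub (fun i => pslStab (U i)) ψ) → φ = ψ) ∧
        (∀ K : Subgroup (Fin m → Matrix.ProjectiveSpecialLinearGroup (Fin d) F),
          IsPComplement p K → ∃ φ : Fin m → Fin 2, ConjIn
            (powSub (fun i => pslStab (U i)) φ) K) ∧
        numConjClasses p
          (Fin m → Matrix.ProjectiveSpecialLinearGroup (Fin d) F) = 2 ^ m ∧
        (∀ K L : Subgroup (Fin m → Matrix.ProjectiveSpecialLinearGroup (Fin d) F),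
          IsPComplement p K → IsPComplement p L →
          AutConj K L)) ∧
      -- the wreath products of `PSL_d(q)` by cyclic groups of order `p ^ e`
      (∀ e : ℕ, 1 ≤ e →
        (∀ φ : Multiplicative (ZMod (p ^ e)) → Fin 2, IsPComplement p
          (wreathSub (fun i => pslStab (U i)) φ)) ∧
        (∀ φ ψ : Multiplicative (ZMod (p ^ e)) → Fin 2,
          ConjIn
            (wreathSub (fun i => pslStab (U i)) φ)
            (wreathSub (fun i => pslStab (U i)) ψ) ↔
          ∃ c, ψ = shift c φ) ∧
        (∀ φ : Multiplicative (ZMod (p ^ e)) → Fin 2, ∃ f ≤ e,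
          Set.ncard {ψ | ∃ c, ψ = shift c φ} = p ^ f ∧
          Set.ncard {L | ConjIn
            (wreathSub (fun i => pslStab (U i)) φ) L} =
              p ^ (k * p ^ e + f)) ∧
        (∀ f ≤ e, ∃ φ : Multiplicative (ZMod (p ^ e)) → Fin 2,
          Set.ncard {ψ | ∃ c, ψ = shift c φ} = p ^ f) ∧
        (∀ K L : Subgroup (CyclicWreath
            (Matrix.ProjectiveSpecialLinearGroup (Fin d) F) (p ^ e)),
          IsPComplement p K → IsPComplement p L →
          Isom K L) ∧
        e + 1 ≤ numAutOrbits p (CyclicWreath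
          (Matrix.ProjectiveSpecialLinearGroup (Fin d) F) (p ^ e))) ∧
      -- the group `GL_d(q)`
      ((∀ i, IsPComplement p (glStab (U i))) ∧
        AutConj (glStab (U 0)) (glStab (U 1)) ∧
        ¬ ConjIn (glStab (U 0)) (glStab (U 1))) ∧
      -- the group `AGL_d(q)` and its cartesian powers
      ((∀ i, IsPComplement p (aglStab (U i))) ∧
        ¬ Isom (aglStab (U 0)) (aglStab (U 1))) ∧
      (∀ m : ℕ,
        (∀ φ : Fin m → Fin 2, IsPComplement p
          (powSub (fun i => aglStab (U i)) φ)) ∧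
        (∀ φ ψ : Fin m → Fin 2, ConjIn
          (powSub (fun i => aglStab (U i)) φ)
          (powSub (fun i => aglStab (U i)) ψ) → φ = ψ) ∧
        (∀ φ ψ : Fin m → Fin 2, Isom
          (powSub (fun i => aglStab (U i)) φ)
          (powSub (fun i => aglStab (U i)) ψ) ↔
            Set.ncard {j | φ j = 1} = Set.ncard {j | ψ j = 1}) ∧
        numIsoClasses p (Fin m → AGL F d) = m + 1)) ∧
    -- consequently the following finite groups exist
    (∀ m : ℕ, ∃ (G : Type) (_ : Group G) (_ : Finite G),
      (∀ K L : Subgroup G, IsPComplement p K → IsPComplement p L →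
        AutConj K L) ∧
      numConjClasses p G = 2 ^ m) ∧
    (∀ e : ℕ, 1 ≤ e → ∃ (G : Type) (_ : Group G) (_ : Finite G),
      (∀ K L : Subgroup G, IsPComplement p K → IsPComplement p L →
        Isom K L) ∧
      e + 1 ≤ numAutOrbits p G) ∧
    (∀ m : ℕ, ∃ (G : Type) (_ : Group G) (_ : Finite G),
      numIsoClasses p G = m + 1) := by
  have hprime : p.Prime := hp.1
  refine ⟨?_, ?_, ?_, ?_⟩
  · intro F _ _ d k hd hk h U hU₀ hU₁
    replace h := mul_sub_one_eq_of_div Finite.one_lt_card h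
    have hpsl := isComplSystem_psl hprime hd hk h hU₀ hU₁
    have hpsl' := autConj_pslStab hd hU₀ hU₁
    have hgl := isComplSystem_gl hprime hd hk h hU₀ hU₁
    have hagl := isComplSystem_agl hprime hd hk h hU₀ hU₁
    obtain ⟨hmon, hlt⟩ := isMonolith_and_card_lt hd hU₀ hU₁
    refine ⟨fun m => ?_, fun e _ => ?_, ?_, ?_, fun m => ?_⟩
    · exact ⟨isPComplement_powSub hpsl, fun _ _ => eq_of_conjIn_powSub hpsl,
        fun _ => exists_conjIn_powSub hprime hpsl, numConjClasses_pow hprime hpsl m,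
        fun _ _ => autConj_of_isPComplement hprime hpsl hpsl'⟩
    · have : NeZero (p ^ e) := ⟨pow_ne_zero _ hprime.ne_zero⟩
      refine ⟨isPComplement_wreathSub hprime hpsl,
        fun _ _ => conjIn_wreathSub_wreathSub_iff hpsl, fun φ => ?_,
        fun _ => exists_shift_orbit hprime,
        fun _ _ => isom_of_isPComplement_wreath hprime hpsl hpsl',
        le_numAutOrbits_wreath hprime hpsl⟩
      obtain ⟨f, hf, hφ⟩ := exists_ncard_shift_eq hprime φ
      exact ⟨f, hf, hφ, by rw [ncard_conj_wreathSub hpsl hprime, hφ, ← pow_add, add_comm]⟩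
    · exact ⟨hgl.isPComplement, autConj_glStab hd hU₀ hU₁,
        fun h => zero_ne_one (hgl.eq_of_conjIn 0 1 h)⟩
    · exact ⟨hagl.isPComplement, not_isom_of_isMonolith hmon hlt⟩
    · exact ⟨isPComplement_powSub hagl, fun _ _ => eq_of_conjIn_powSub hagl,
        isom_powSub_iff hmon hlt, numIsoClasses_pow hprime hagl hmon hlt m⟩
  all_goals
    obtain ⟨F, _, _, d, k, U, hd, hk, h, hU₀, hU₁⟩ := exists_of_mem_NC hp
    have hpsl := isComplSystem_psl hprime hd hk h hU₀ hU₁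
    have hpsl' := autConj_pslStab hd hU₀ hU₁
  · exact fun m => ⟨Fin m → Matrix.ProjectiveSpecialLinearGroup (Fin d) F, inferInstance,
      inferInstance, fun _ _ => autConj_of_isPComplement hprime hpsl hpsl',
      numConjClasses_pow hprime hpsl m⟩
  · intro e _
    have : NeZero (p ^ e) := ⟨pow_ne_zero _ hprime.ne_zero⟩
    exact ⟨CyclicWreath (Matrix.ProjectiveSpecialLinearGroup (Fin d) F) (p ^ e), inferInstance,
      inferInstance, fun _ _ => isom_of_isPComplement_wreath hprime hpsl hpsl',
      le_numAutOrbits_wreath hprime hpsl⟩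
  · obtain ⟨hmon, hlt⟩ := isMonolith_and_card_lt hd hU₀ hU₁
    exact fun m => ⟨Fin m → AGL F d, inferInstance, inferInstance,
      numIsoClasses_pow hprime (isComplSystem_agl hprime hd hk h hU₀ hU₁) hmon hlt m⟩
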